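/- A convex polytope in $\mathbb{R}^d$ is the convex hull of a nonempty finite set of points, and its geometric symmetry group $G(\mathcal{P})$ is the group of all Euclidean isometries of $\mathbb{R}^d$ that map $\mathcal{P}$ onto itself. For a group $\Gamma$, let $\operatorname{gcpd}(\Gamma)$ (the geometric convex polytope dimension of $\Gamma$) be the minimum integer $d\ge 0$ such that there is a convex polytope $\mathcal{P}$ in $\mathbb{R}^d$ with $G(\mathcal{P})\cong\Gamma$. The following holds (including the existence of the minimum), both when $\mathcal{P}$ ranges over all convex polytopes in $\mathbb{R}^d$ and when it ranges only over those whose affine hull is $\mathbb{R}^d$. 1. For every $n\ge 1$, $\operatorname{gcpd}(S_n)=n-1$, where $S_n$ is the symmetric group on $n$ letters. 2. Let $p$ be an odd prime and let $\Gamma$ be an extraspecial $p$-group of order $p^{2k+1}$; that is, the center $Z(\Gamma)$ has order $p$ and equals the commutator subgroup of $\Gamma$, and $\Gamma/Z(\Gamma)$ is elementary abelian. Then $\operatorname{gcpd}(\Gamma)=2p^k$. 3. Let $\mathbb{F}_q$ be a finite field with $q$ elements, and let $\operatorname{Aff}(\mathbb{F}_q)$ be the affine group of degree $1$ over $\mathbb{F}_q$,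 that is, the group of all maps $\mathbb{F}_q\to\mathbb{F}_q$ of the form $x\mapsto ax+b$ with $a,b\in\mathbb{F}_q$, $a\ne 0$. Then $\operatorname{gcpd}(\operatorname{Aff}(\mathbb{F}_q))=q-1$. -/

import Mathlib

/-- A convex polytope in `ℝ^d`: the convex hull of a nonempty finite set of points. -/
def IsConvexPolytope {d : ℕ} (P : Set (EuclideanSpace ℝ (Fin d))) : Prop :=
  ∃ V : Set (EuclideanSpace ℝ (Fin d)), V.Finite ∧ V.Nonempty ∧ P = convexHull ℝ V

/-- The geometric symmetry group `G(P)`: all isometries of the ambient Euclidean space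
that map `P` onto itself. -/
def geomSymmetryGroup {d : ℕ} (P : Set (EuclideanSpace ℝ (Fin d))) :
    Subgroup (EuclideanSpace ℝ (Fin d) ≃ᵢ EuclideanSpace ℝ (Fin d)) where
  carrier := {f | f '' P = P}
  one_mem' := by
    change (fun x => x) '' P = P
    simp
  mul_mem' := by
    intro f g hf hg
    change (fun x => f (g x)) '' P = P
    rw [← Set.image_image (fun x => f x) (fun x => g x) P]
    exact (congrArg (fun s => (fun x => f x) '' s) hg).trans hf
  inv_mem' := by
    intro f hf
    change f.symm '' P = P
    have hf' : f '' P = P := hf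
    conv_lhs => rw [← hf', Set.image_image]
    simp

/-- `G(P) ≅ Γ` for some convex polytope `P` in `ℝ^d` (possibly lying in a proper affine
subspace). -/
def IsRealizedIn (Γ : Type*) [Group Γ] (d : ℕ) : Prop :=
  ∃ P : Set (EuclideanSpace ℝ (Fin d)),
    IsConvexPolytope P ∧ Nonempty (geomSymmetryGroup P ≃* Γ)

/-- `G(P) ≅ Γ` for some `d`-polytope `P` in `ℝ^d`, that is, a convex polytope whose affine
hull is all of `ℝ^d`. -/
def IsRealizedFullDim (Γ : Type*) [Group Γ] (d : ℕ) : Prop :=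
  ∃ P : Set (EuclideanSpace ℝ (Fin d)),
    IsConvexPolytope P ∧ affineSpan ℝ P = ⊤ ∧ Nonempty (geomSymmetryGroup P ≃* Γ)

/-- `gcpd(Γ) = d`: the minimum exists and equals `d`, both when `P` ranges over all convex
polytopes in `ℝ^d` and when it ranges over the full-dimensional ones only. -/
def HasGcpd (Γ : Type*) [Group Γ] (d : ℕ) : Prop :=
  IsLeast {e : ℕ | IsRealizedIn Γ e} d ∧ IsLeast {e : ℕ | IsRealizedFullDim Γ e} d

/-- An extraspecial `p`-group: a `p`-group whose center has order `p` and equals the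
commutator subgroup, and whose quotient by the center is elementary abelian (it is abelian
because the center is the commutator subgroup). -/
structure IsExtraspecial (p : ℕ) (Γ : Type*) [Group Γ] : Prop where
  isPGroup : IsPGroup p Γ
  card_center : Nat.card (Subgroup.center Γ) = p
  commutator_eq_center : commutator Γ = Subgroup.center Γ
  pow_eq_one : ∀ x : Γ ⧸ Subgroup.center Γ, x ^ p = 1

/-- The affine group of degree one over a field `K`: all maps `x ↦ a * x + b` from `K` to `K`
with `a ≠ 0`, under composition. -/
def affineGroup (K : Type*) [Field K] : Subgroup (Equiv.Perm K) where
  carrier := {σ | ∃ a b : K, a ≠ 0 ∧ ∀ x, σ x = a * x + b}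
  one_mem' := ⟨1, 0, one_ne_zero, fun x => by simp⟩
  mul_mem' := by
    rintro σ τ ⟨a, b, ha, h⟩ ⟨c, e, hc, h'⟩
    refine ⟨a * c, a * e + b, mul_ne_zero ha hc, fun x => ?_⟩
    rw [Equiv.Perm.mul_apply, h, h']
    ring
  inv_mem' := by
    rintro σ ⟨a, b, ha, h⟩
    refine ⟨a⁻¹, -(a⁻¹ * b), inv_ne_zero ha, fun x => ?_⟩
    rw [Equiv.Perm.inv_eq_iff_eq, h]
    field_simp
    ring

/-!
The value of `gcpd` is the least dimension of a faithful orthogonal representation of the group.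

On one side, the isometries preserving a polytope form a group isomorphic to the finite group `Γ`,
and the linear parts of these isometries give a faithful orthogonal representation, because a
nontrivial translation has infinite order (`IsRealizedIn.exists_representation`). On the other side,
let `Γ` act faithfully and orthogonally on a space without nonzero fixed vectors. The convex hull of
the orbits of an orthonormal basis and of one further generic vector, slightly shorter than the
others, has no symmetries besides those of `Γ`: a symmetry fixes the centroid, which is the origin,
permutes the vertices and preserves norms, so after composition with an element of `Γ` it fixes the
generic vector, whose inner products with the other vertices tell them apart
(`isRealizedFullDim_of_representation`). It remains to find the least dimension in each case.

A faithful transitive permutation group of degree `n` acts faithfully on the vectors of coordinate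
sum zero in `ℝⁿ`, without nonzero fixed vectors. This gives the upper bounds `n - 1` and `q - 1` for
the symmetric and the affine groups (`hasGcpd_of_transitive`).

For the lower bound for the affine group, some nontrivial character of the translations occurs in
the complexification, and its `q - 1` conjugates under the homotheties are distinct
(`affineGroup_le_of_faithful`).

For the symmetric group, suppose that disjoint transpositions act differently and that the
dimension is less than `n - 1`. The permutations commuting with a transposition `t` and fixing its
two points act on both eigenspaces of `t`. By induction the eigenspace on which they separate
disjoint transpositions has dimension at least `n - 3`, so that the other is a line (for `n ≤ 5`
some eigenspace is a line for lack of room), and up to the sign character all transpositions are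
reflections. The normals of the transpositions moving a fixed
point then have a positive definite Gram matrix, so there are `n - 1` independent ones
(`SeparatesDisjointSwaps.card_sub_one_le`).

For an extraspecial group, let `χ` be a faithful character of the center `Z`. In a complex
representation in which `Z` acts through `χ`, operators for different cosets of `Z` are eigenvectors
of different characters under conjugation, so they are independent and the dimension is at least
`p ^ k`. For an irreducible representation, Burnside's theorem says that these operators span, so
the dimension is exactly `p ^ k`. The complexification of a faithful real representation contains
both some `χ` and its complex conjugate, which gives the lower bound `2 * p ^ k`
(`IsExtraspecial.le_of_faithful`). An irreducible complex representation over `χ`, regarded as a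
real one, attains it (`hasGcpd_of_isExtraspecial`).
-/

open scoped RealInnerProductSpace commutatorElement

/-! ### Finite invariant sets whose convex hull has the prescribed symmetries -/

section Polytope

variable {E : Type*} [NormedAddCommGroup E] [InnerProductSpace ℝ E]

theorem inner_lt_inner_self_of_norm_eq {x y : E} (h : ‖y‖ = ‖x‖) (hne : y ≠ x) :
    ⟪x, y⟫ < ⟪x, x⟫ := by
  have h1 := norm_sub_sq_real x y
  have h2 : 0 < ‖x - y‖ ^ 2 := by
    have : 0 < ‖x - y‖ := norm_pos_iff.2 (sub_ne_zero.2 hne.symm)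
    positivity
  rw [real_inner_self_eq_norm_sq]
  rw [h] at h1
  linarith

/-- The points of `X` lie in the convex set consisting of `x` and the open half-space
`⟪x, ·⟫ < ⟪x, x⟫`, of which `x` is an extreme point. -/
theorem extremePoints_convexHull_of_inner_lt {X : Set E}
    (h : ∀ x ∈ X, ∀ y ∈ X, y ≠ x → ⟪x, y⟫ < ⟪x, x⟫) :
    (convexHull ℝ X).extremePoints ℝ = X := by
  refine Set.Subset.antisymm extremePoints_convexHull_subset fun x hx => ?_
  have key : ∀ y ∈ convexHull ℝ X, y = x ∨ ⟪x, y⟫ < ⟪x, x⟫ := by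
    have hconv : Convex ℝ {y | y = x ∨ ⟪x, y⟫ < ⟪x, x⟫} := by
      intro y hy z hz a b ha hb hab
      simp only [Set.mem_ofPred_eq, inner_add_right, inner_smul_right] at hy hz ⊢
      rcases hy with rfl | hy
      · rcases hz with rfl | hz
        · left
          rw [← add_smul, hab, one_smul]
        · rcases hb.eq_or_lt with rfl | hb
          · left
            have : a = 1 := by linarith
            simp [this]
          · right
            have : a = 1 - b := by linarith
            subst this
            nlinarith
      · rcases ha.eq_or_lt with rfl | ha
        · have : b = 1 := by linarith
          subst this
          simpa using hz
        · right
          have hz' : ⟪x, z⟫ ≤ ⟪x, x⟫ := by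
            rcases hz with rfl | hz
            · exact le_rfl
            · exact hz.le
          have : b = 1 - a := by linarith
          subst this
          nlinarith
    exact convexHull_min (fun y hy => by
      by_cases hyx : y = x
      · exact Or.inl hyx
      · exact Or.inr (h x hx y hy hyx)) hconv
  have hle : ∀ y ∈ convexHull ℝ X, ⟪x, y⟫ ≤ ⟪x, x⟫ := fun y hy => by
    rcases key y hy with rfl | h
    · exact le_rfl
    · exact h.le
  refine ⟨subset_convexHull ℝ X hx, ?_⟩
  intro y hy z hz hyz
  rcases key y hy with rfl | hlt
  · rfl
  · exfalso
    obtain ⟨a, b, ha, hb, hab, hxe⟩ := hyz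
    have h1 : ⟪x, a • y + b • z⟫ = ⟪x, x⟫ := by rw [hxe]
    rw [inner_add_right, inner_smul_right, inner_smul_right] at h1
    have h2 := hle z hz
    have : b = 1 - a := by linarith
    subst this
    nlinarith

/-- A unit vector can be chosen outside finitely many proper subspaces. -/
theorem exists_notMem_of_forall_ne_top [Nontrivial E] {s : Set (Submodule ℝ E)} (hs : s.Finite)
    (h : ∀ p ∈ s, p ≠ ⊤) : ∃ v : E, ‖v‖ = 1 ∧ ∀ p ∈ s, v ∉ p := by
  classical
  have h1 : ⊤ ∉ insert ⊥ hs.toFinset := by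
    simp only [Finset.mem_insert, Set.Finite.mem_toFinset, not_or]
    exact ⟨top_ne_bot, fun ht => h ⊤ ht rfl⟩
  have h2 := Subspace.biUnion_ne_univ_of_top_notMem h1
  obtain ⟨v, hv⟩ := (Set.ne_univ_iff_exists_notMem _).1 h2
  simp only [Finset.mem_insert, Set.Finite.mem_toFinset, Set.mem_iUnion, not_exists] at hv
  have hv0 : v ≠ 0 := fun h0 => hv ⊥ (Or.inl rfl) (by simp [h0])
  have hn : ‖v‖ ≠ 0 := norm_ne_zero_iff.2 hv0
  refine ⟨‖v‖⁻¹ • v, by rw [norm_smul, norm_inv, norm_norm, inv_mul_cancel₀ hn], fun p hp hm => ?_⟩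
  refine hv p (Or.inr hp) ?_
  have := p.smul_mem ‖v‖ hm
  rwa [smul_smul, mul_inv_cancel₀ hn, one_smul] at this

variable {G : Type*} [Group G]

theorem Representation.inner_apply_apply {ρ : Representation ℝ G E} (hn : ∀ g v, ‖ρ g v‖ = ‖v‖)
    (g : G) (v w : E) : ⟪ρ g v, ρ g w⟫ = ⟪v, w⟫ := by
  exact LinearIsometry.inner_map_map (⟨ρ g, hn g⟩ : E →ₗᵢ[ℝ] E) v w

/-- A finite spanning set invariant under `ρ`, to serve as the vertex set of a polytope. By
`inner_lt` every point `x` is the unique maximizer of `⟪x, ·⟫` on `X`, hence a vertex of the convex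
hull; by `exists_eq` no linear isometry preserves `X` except those in the image of `ρ`. -/
structure IsVertexSystem (ρ : Representation ℝ G E) (X : Set E) : Prop where
  finite : X.Finite
  nonempty : X.Nonempty
  map_mem : ∀ g, ∀ x ∈ X, ρ g x ∈ X
  inner_lt : ∀ x ∈ X, ∀ y ∈ X, y ≠ x → ⟪x, y⟫ < ⟪x, x⟫
  span_eq_top : Submodule.span ℝ X = ⊤
  exists_eq : ∀ f : E →ₗᵢ[ℝ] E, (∀ x ∈ X, f x ∈ X) → ∃ g, ∀ v, f v = ρ g v

/-- In dimension at most `1` a linear isometry is `1` or `-1`, and the orbit of a spanning vector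
suffices. -/
theorem IsVertexSystem.exists_of_finrank_le_one [Finite G] [FiniteDimensional ℝ E]
    {ρ : Representation ℝ G E} (hn : ∀ g v, ‖ρ g v‖ = ‖v‖)
    (hfix : ∀ v, (∀ g, ρ g v = v) → v = 0) (hd : Module.finrank ℝ E ≤ 1) :
    ∃ X, IsVertexSystem ρ X := by
  obtain ⟨v, hv⟩ := finrank_le_one_iff.1 hd
  have hsmul : ∀ c : ℝ, ‖c • v‖ = ‖v‖ → c • v = v ∨ c • v = -v := by
    intro c hc
    rw [norm_smul] at hc
    by_cases h0 : v = 0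
    · simp [h0]
    · have hc1 : |c| = 1 := by
        have := norm_ne_zero_iff.2 h0
        exact mul_right_cancel₀ this (by simpa using hc)
      rcases (abs_eq zero_le_one).1 hc1 with rfl | rfl <;> simp
  have hneg : ∃ g, ρ g v = -v := by
    by_cases h0 : v = 0
    · exact ⟨1, by simp [h0]⟩
    · by_contra! hcon
      refine h0 (hfix v fun g => ?_)
      obtain ⟨c, hc⟩ := hv (ρ g v)
      have := hsmul c (by rw [hc, hn])
      rw [hc] at this
      exact this.resolve_right (hcon g)
  refine ⟨Set.range fun g => ρ g v, Set.finite_range _, ⟨_, 1, rfl⟩, ?_, ?_, ?_, ?_⟩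
  · rintro g _ ⟨h, rfl⟩
    exact ⟨g * h, by simp⟩
  · rintro _ ⟨g, rfl⟩ _ ⟨h, rfl⟩ hne
    exact inner_lt_inner_self_of_norm_eq (by simp only [hn]) hne
  · rw [eq_top_iff]
    rintro w -
    obtain ⟨c, rfl⟩ := hv w
    exact Submodule.smul_mem _ _ (Submodule.subset_span ⟨1, by simp⟩)
  · intro f _
    have hext : ∀ g, f v = ρ g v → ∃ g, ∀ w, f w = ρ g w := fun g hg => ⟨g, fun w => by
      obtain ⟨c, rfl⟩ := hv w
      rw [map_smul, map_smul, hg]⟩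
    obtain ⟨c, hc⟩ := hv (f v)
    rcases hsmul c (by rw [hc, f.norm_map]) with h | h
    · exact hext 1 (by rw [← hc, h]; simp)
    · obtain ⟨g, hg⟩ := hneg
      exact hext g (by rw [← hc, h, hg])

/-- In dimension at least `2`, take the union of a set `Y` of unit vectors (the orbits of an
orthonormal basis) and the orbit of `r • v`, with `v` a generic unit vector and `r < 1` close to
`1`. An isometry preserving the union preserves both parts, because their norms differ. Once it is
composed with a group element so as to fix `v`, it also fixes each point of `Y`, because the inner
products of `v` with the points of `Y` are distinct. -/
theorem IsVertexSystem.exists_of_one_lt_finrank [Finite G] [FiniteDimensional ℝ E]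
    {ρ : Representation ℝ G E} (hn : ∀ g v, ‖ρ g v‖ = ‖v‖) (hd : 1 < Module.finrank ℝ E) :
    ∃ X, IsVertexSystem ρ X := by
  have : Nontrivial E := Module.nontrivial_of_finrank_pos (R := ℝ) (by omega)
  set b := stdOrthonormalBasis ℝ E
  set Y : Set E := Set.range fun i : G × Fin (Module.finrank ℝ E) => ρ i.1 (b i.2) with hY
  have hYfin : Y.Finite := Set.finite_range _
  have hYnorm : ∀ y ∈ Y, ‖y‖ = 1 := by
    rintro _ ⟨i, rfl⟩
    simp [hn]
  have hYmap : ∀ g, ∀ y ∈ Y, ρ g y ∈ Y := by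
    rintro g _ ⟨i, rfl⟩
    exact ⟨(g * i.1, i.2), by simp⟩
  have hYspan : Submodule.span ℝ Y = ⊤ := by
    rw [eq_top_iff, ← b.toBasis.span_eq]
    refine Submodule.span_mono ?_
    rintro _ ⟨i, rfl⟩
    exact ⟨(1, i), by simp⟩
  -- The vector `v` separates the points of `Y` by inner products and is not a multiple of any
  -- of them.
  obtain ⟨v, hv1, hv⟩ := exists_notMem_of_forall_ne_top (E := E)
    (s := (fun q : E × E => (Submodule.span ℝ {q.1 - q.2})ᗮ) '' {q ∈ Y ×ˢ Y | q.1 ≠ q.2} ∪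
      (fun y => Submodule.span ℝ {y}) '' Y)
    ((((hYfin.prod hYfin).subset (Set.sep_subset _ _)).image _).union (hYfin.image _)) (by
      rintro _ (⟨q, hq, rfl⟩ | ⟨y, -, rfl⟩) htop
      · rw [Submodule.orthogonal_eq_top_iff, Submodule.span_singleton_eq_bot] at htop
        exact hq.2 (sub_eq_zero.1 htop)
      · have h1 := finrank_span_le_card (R := ℝ) ({y} : Set E)
        rw [Set.toFinset_singleton, Finset.card_singleton] at h1
        dsimp only at htop
        rw [htop, finrank_top] at h1
        omega)
  have hsep : ∀ y ∈ Y, ∀ z ∈ Y, ⟪y, v⟫ = ⟪z, v⟫ → y = z := by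
    intro y hy z hz hyz
    by_contra hne
    refine hv _ (Or.inl ⟨(y, z), ⟨⟨hy, hz⟩, hne⟩, rfl⟩) ?_
    rw [Submodule.mem_orthogonal_singleton_iff_inner_right, inner_sub_left, hyz, sub_self]
  have hvY : ∀ g, ρ g v ∉ Y := by
    intro g hg
    refine hv _ (Or.inr ⟨v, ?_, rfl⟩) (Submodule.mem_span_singleton_self v)
    simpa using hYmap g⁻¹ _ hg
  have hlt1 : ∀ g, ∀ y ∈ Y, ⟪ρ g v, y⟫ < 1 := by
    intro g y hy
    have h := inner_lt_inner_self_of_norm_eq (x := ρ g v) (y := y)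
      (by rw [hYnorm y hy, hn, hv1]) (fun h => hvY g (h ▸ hy))
    rwa [real_inner_self_eq_norm_sq, hn, hv1, one_pow] at h
  obtain ⟨r, hr0, hr1, hr⟩ : ∃ r : ℝ, 0 < r ∧ r < 1 ∧ ∀ g, ∀ y ∈ Y, ⟪ρ g v, y⟫ < r := by
    have hfin : (insert 0 ((fun q : G × E => ⟪ρ q.1 v, q.2⟫) '' (Set.univ ×ˢ Y))).Finite :=
      ((Set.finite_univ.prod hYfin).image _).insert 0
    obtain ⟨m, hm, hmax⟩ := Set.exists_max_image _ id hfin ⟨0, Set.mem_insert _ _⟩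
    have hm1 : m < 1 := by
      rcases hm with rfl | ⟨q, hq, rfl⟩
      · exact zero_lt_one
      · exact hlt1 q.1 q.2 hq.2
    obtain ⟨r, hmr, hr1⟩ := exists_between hm1
    refine ⟨r, (hmax 0 (Set.mem_insert _ _)).trans_lt hmr, hr1, fun g y hy => ?_⟩
    exact (hmax _ (Set.mem_insert_of_mem _ ⟨(g, y), ⟨Set.mem_univ _, hy⟩, rfl⟩)).trans_lt hmr
  set O : Set E := Set.range fun g => r • ρ g v with hO
  have hOnorm : ∀ x ∈ O, ‖x‖ = r := by
    rintro _ ⟨g, rfl⟩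
    simp [norm_smul, hn, hv1, abs_of_pos hr0]
  refine ⟨Y ∪ O, hYfin.union (Set.finite_range _), ⟨_, Or.inr ⟨1, rfl⟩⟩, ?_, ?_, ?_, ?_⟩
  · rintro g x (hx | ⟨h, rfl⟩)
    · exact Or.inl (hYmap g x hx)
    · exact Or.inr ⟨g * h, by simp⟩
  · rintro x (hx | hx) y (hy | hy) hne
    · exact inner_lt_inner_self_of_norm_eq (by rw [hYnorm x hx, hYnorm y hy]) hne
    · obtain ⟨g, rfl⟩ := hy
      rw [real_inner_self_eq_norm_sq, hYnorm x hx, inner_smul_right, real_inner_comm]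
      nlinarith [hlt1 g x hx]
    · obtain ⟨g, rfl⟩ := hx
      rw [real_inner_self_eq_norm_sq, hOnorm _ ⟨g, rfl⟩, inner_smul_left]
      simp only [conj_trivial]
      nlinarith [hr g y hy]
    · exact inner_lt_inner_self_of_norm_eq (by rw [hOnorm x hx, hOnorm y hy]) hne
  · rw [eq_top_iff, ← hYspan]
    exact Submodule.span_mono Set.subset_union_left
  · intro f hf
    have hfY : ∀ y ∈ Y, f y ∈ Y := fun y hy => (hf y (Or.inl hy)).resolve_right fun h => by
      have := hOnorm _ h
      rw [f.norm_map, hYnorm y hy] at this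
      exact hr1.ne' this
    have hfv : f (r • v) ∈ O := (hf _ (Or.inr ⟨1, by simp⟩)).resolve_left fun h => by
      have := hYnorm _ h
      rw [f.norm_map, hOnorm _ ⟨1, by simp⟩] at this
      exact hr1.ne this
    obtain ⟨g, hg⟩ := hfv
    have hg : ρ g v = f v := by
      simp only [map_smul] at hg
      exact smul_right_injective E hr0.ne' hg
    refine ⟨g, fun w => ?_⟩
    have hY' : ∀ y ∈ Y, f y = ρ g y := by
      intro y hy
      have h1 : ρ g⁻¹ (f y) = y := by
        refine hsep _ (hYmap _ _ (hfY y hy)) _ hy ?_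
        rw [← Representation.inner_apply_apply hn g, ← f.inner_map_map y v, hg]
        simp
      nth_rw 2 [← h1]
      simp
    exact LinearMap.congr_fun (LinearMap.ext_on (f := f.toLinearMap) hYspan hY') w

theorem IsVertexSystem.exists_of_isometric [Finite G] [FiniteDimensional ℝ E]
    {ρ : Representation ℝ G E} (hn : ∀ g v, ‖ρ g v‖ = ‖v‖)
    (hfix : ∀ v, (∀ g, ρ g v = v) → v = 0) : ∃ X, IsVertexSystem ρ X := by
  rcases le_or_gt (Module.finrank ℝ E) 1 with hd | hd
  · exact IsVertexSystem.exists_of_finrank_le_one hn hfix hd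
  · exact IsVertexSystem.exists_of_one_lt_finrank hn hd

theorem Representation.sum_eq_zero_of_map_mem {ρ : Representation ℝ G E}
    (hfix : ∀ v, (∀ g, ρ g v = v) → v = 0) (X : Finset E) (hX : ∀ g, ∀ x ∈ X, ρ g x ∈ X) :
    ∑ x ∈ X, x = 0 := by
  refine hfix _ fun g => ?_
  rw [map_sum]
  refine Finset.sum_bij (fun x _ => ρ g x) (fun x hx => hX g x hx) ?_ ?_ fun _ _ => rfl
  · intro x _ y _ hxy
    simpa using congrArg (ρ g⁻¹) hxy
  · intro y hy
    exact ⟨ρ g⁻¹ y, hX _ _ hy, by simp⟩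

end Polytope

/-! ### Polytopes from representations and representations from polytopes -/

section Realization

variable {d : ℕ} {G : Type*} [Group G]

theorem IsometryEquiv.apply_mem_extremePoints {E : Type*} [NormedAddCommGroup E]
    [NormedSpace ℝ E] {P : Set E} {f : E ≃ᵢ E} (hf : f '' P = P) {x : E}
    (hx : x ∈ P.extremePoints ℝ) : f x ∈ P.extremePoints ℝ := by
  have hmem : ∀ y ∈ P, f.symm y ∈ P := by
    intro y hy
    rw [← hf] at hy
    obtain ⟨z, hz, rfl⟩ := hy
    simpa using hz
  refine ⟨hf ▸ Set.mem_image_of_mem f hx.1, fun a ha b hb hab => ?_⟩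
  have h1 : x ∈ openSegment ℝ (f.symm a) (f.symm b) := by
    have h2 := image_openSegment ℝ f.symm.toRealAffineIsometryEquiv.toAffineEquiv.toAffineMap a b
    have h3 := Set.mem_image_of_mem
      (f.symm.toRealAffineIsometryEquiv.toAffineEquiv.toAffineMap) hab
    rw [h2] at h3
    simpa using h3
  have := hx.2 (hmem a ha) (hmem b hb) h1
  rw [← this]
  simp

/-- An isometric representation, viewed as an action by isometries. -/
noncomputable def Representation.toIsometryEquivHom {E : Type*} [NormedAddCommGroup E]
    [InnerProductSpace ℝ E] (ρ : Representation ℝ G E) (hn : ∀ g v, ‖ρ g v‖ = ‖v‖) :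
    G →* (E ≃ᵢ E) where
  toFun g := IsometryEquiv.mk' (ρ g) (ρ g⁻¹) (fun v => by simp)
    (Isometry.of_dist_eq fun v w => by rw [dist_eq_norm, dist_eq_norm, ← map_sub, hn])
  map_one' := by
    ext v
    simp [IsometryEquiv.mk']
  map_mul' g h := by
    ext v
    simp [IsometryEquiv.mk']

/-- An isometry preserving the convex hull of `X` permutes its extreme points, which are the points
of `X`, and fixes their centroid `0`; hence it is linear and comes from the group. -/
theorem IsVertexSystem.isRealizedFullDim {ρ : Representation ℝ G (EuclideanSpace ℝ (Fin d))}
    {X : Set (EuclideanSpace ℝ (Fin d))} (hX : IsVertexSystem ρ X) (hn : ∀ g v, ‖ρ g v‖ = ‖v‖)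
    (hinj : Function.Injective ρ) (hfix : ∀ v, (∀ g, ρ g v = v) → v = 0) :
    IsRealizedFullDim G d := by
  have hext := extremePoints_convexHull_of_inner_lt hX.inner_lt
  have hsum := Representation.sum_eq_zero_of_map_mem hfix hX.finite.toFinset (by
    simpa using hX.map_mem)
  have hne : hX.finite.toFinset.Nonempty := by simpa using hX.nonempty
  have hmap : ∀ g, ρ.toIsometryEquivHom hn g ∈ geomSymmetryGroup (convexHull ℝ X) := by
    intro g
    have hg : ρ g '' X = X := by
      refine Set.Subset.antisymm (Set.image_subset_iff.2 (hX.map_mem g)) fun x hx => ?_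
      exact ⟨ρ g⁻¹ x, hX.map_mem _ _ hx, by simp⟩
    change ρ g '' convexHull ℝ X = convexHull ℝ X
    rw [(ρ g).image_convexHull, hg]
  refine ⟨convexHull ℝ X, ⟨X, hX.finite, hX.nonempty, rfl⟩, ?_, ⟨MulEquiv.symm <|
    MulEquiv.ofBijective ((ρ.toIsometryEquivHom hn).codRestrict _ hmap) ⟨?_, ?_⟩⟩⟩
  · have h0 : (0 : EuclideanSpace ℝ (Fin d)) ∈ affineSpan ℝ (convexHull ℝ X) := by
      rw [affineSpan_convexHull]
      refine convexHull_subset_affineSpan X ?_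
      have := Finset.centerMass_mem_convexHull (R := ℝ) hX.finite.toFinset (w := fun _ => 1)
        (z := id) (s := X) (fun _ _ => zero_le_one) (by simpa using hX.nonempty) (by simp)
      simpa [Finset.centerMass, hsum] using this
    rw [affineSpan_convexHull] at h0 ⊢
    rw [← AffineSubspace.direction_eq_top_iff_of_nonempty ⟨0, h0⟩, eq_top_iff,
      ← hX.span_eq_top, Submodule.span_le]
    intro x hx
    simpa using AffineSubspace.vsub_mem_direction (subset_affineSpan ℝ X hx) h0
  · intro g h hgh
    refine hinj (LinearMap.ext fun v => ?_)
    exact congrArg (fun f : geomSymmetryGroup (convexHull ℝ X) => f.1 v) hgh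
  · rintro ⟨f, hf⟩
    have hfX : ∀ x ∈ X, f x ∈ X := fun x hx => by
      rw [← hext] at hx ⊢
      exact f.apply_mem_extremePoints hf hx
    -- The isometry `f` is affine, so it fixes the centroid `0` of `X`.
    have hf0 : f 0 = 0 := by
      have h1 : ∑ x ∈ hX.finite.toFinset, f x = 0 := by
        rw [← hsum]
        have himg : hX.finite.toFinset.image f = hX.finite.toFinset := by
          refine Finset.eq_of_subset_of_card_le ?_ ?_
          · intro y hy
            obtain ⟨x, hx, rfl⟩ := Finset.mem_image.1 hy
            simpa using hfX x (by simpa using hx)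
          · rw [Finset.card_image_of_injective _ f.injective]
        conv_rhs => rw [← himg]
        rw [Finset.sum_image f.injective.injOn]
      have h2 : ∀ x, f x = f.toRealLinearIsometryEquiv x + f 0 := fun x => by simp
      rw [Finset.sum_congr rfl fun x _ => h2 x, Finset.sum_add_distrib, ← map_sum, hsum, map_zero,
        zero_add, Finset.sum_const, ← Nat.cast_smul_eq_nsmul ℝ, smul_eq_zero] at h1
      exact h1.resolve_left (Nat.cast_ne_zero.2 (Finset.card_pos.2 hne).ne')
    obtain ⟨g, hg⟩ := hX.exists_eq (f.toRealLinearIsometryEquivOfMapZero hf0).toLinearIsometry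
      hfX
    refine ⟨g, Subtype.ext (IsometryEquiv.ext fun v => (hg v).symm)⟩

/-- A finite group with a faithful isometric representation without nonzero fixed vectors is the
symmetry group of a full-dimensional polytope in the space of the representation. -/
theorem isRealizedFullDim_of_representation [Finite G] {E : Type*} [NormedAddCommGroup E]
    [InnerProductSpace ℝ E] [FiniteDimensional ℝ E] (ρ : Representation ℝ G E)
    (hinj : Function.Injective ρ) (hn : ∀ g v, ‖ρ g v‖ = ‖v‖)
    (hfix : ∀ v, (∀ g, ρ g v = v) → v = 0) (hd : Module.finrank ℝ E = d) :
    IsRealizedFullDim G d := by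
  subst hd
  set e := (stdOrthonormalBasis ℝ E).repr
  let σ : Representation ℝ G (EuclideanSpace ℝ (Fin (Module.finrank ℝ E))) :=
    { toFun := fun g => e.toLinearEquiv.conj (ρ g)
      map_one' := by
        ext v
        simp
      map_mul' := fun g h => by
        rw [map_mul]
        exact e.toLinearEquiv.conj_comp _ _ }
  have hσ : ∀ g v, σ g v = e (ρ g (e.symm v)) := fun g v => rfl
  have hσn : ∀ g v, ‖σ g v‖ = ‖v‖ := fun g v => by rw [hσ, e.norm_map, hn, e.symm.norm_map]
  have hσfix : ∀ v, (∀ g, σ g v = v) → v = 0 := fun v hv => by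
    have := hfix (e.symm v) fun g => by
      have h := congrArg e.symm (hv g)
      rwa [hσ, e.symm_apply_apply] at h
    simpa using this
  obtain ⟨X, hX⟩ := IsVertexSystem.exists_of_isometric hσn hσfix
  exact hX.isRealizedFullDim hσn (fun g h hgh => hinj (e.toLinearEquiv.conj.injective hgh)) hσfix

theorem IsRealizedFullDim.isRealizedIn (h : IsRealizedFullDim G d) : IsRealizedIn G d := by
  obtain ⟨P, hP, -, hG⟩ := h
  exact ⟨P, hP, hG⟩

/-- A finite group of isometries acts faithfully through its linear parts, because a nontrivial
translation has infinite order. -/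
theorem IsRealizedIn.exists_representation [Finite G] (h : IsRealizedIn G d) :
    ∃ ρ : Representation ℝ G (EuclideanSpace ℝ (Fin d)),
      Function.Injective ρ ∧ ∀ g v, ‖ρ g v‖ = ‖v‖ := by
  obtain ⟨P, -, ⟨e⟩⟩ := h
  have happ : ∀ (f : EuclideanSpace ℝ (Fin d) ≃ᵢ EuclideanSpace ℝ (Fin d)) x,
      f x = f.toRealLinearIsometryEquiv x + f 0 := fun f x => by simp
  let F : G → (EuclideanSpace ℝ (Fin d) ≃ᵢ EuclideanSpace ℝ (Fin d)) := fun g => (e.symm g).1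
  have hF1 : F 1 = 1 := by simp [F]
  have hFmul : ∀ g h, F (g * h) = F g * F h := fun g h => by simp [F]
  let ρ : Representation ℝ G (EuclideanSpace ℝ (Fin d)) :=
    { toFun := fun g => (F g).toRealLinearIsometryEquiv.toLinearEquiv.toLinearMap
      map_one' := by
        ext v
        simp [hF1]
      map_mul' := fun g h => by
        refine LinearMap.ext fun v => ?_
        have h1 := (F g).toRealLinearIsometryEquiv.map_sub (F h v) (F h 0)
        rw [IsometryEquiv.toRealLinearIsometryEquiv_apply _ (F h v),
          IsometryEquiv.toRealLinearIsometryEquiv_apply _ (F h 0),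
          ← IsometryEquiv.toRealLinearIsometryEquiv_apply (F h) v] at h1
        change (F (g * h)).toRealLinearIsometryEquiv v =
          (F g).toRealLinearIsometryEquiv ((F h).toRealLinearIsometryEquiv v)
        rw [h1, IsometryEquiv.toRealLinearIsometryEquiv_apply, hFmul, IsometryEquiv.mul_apply,
          IsometryEquiv.mul_apply]
        abel }
  have hρ : ∀ g v, F g v = ρ g v + F g 0 := fun g v => happ (F g) v
  refine ⟨ρ, (injective_iff_map_eq_one ρ).2 fun g hg => ?_, fun g v =>
    (F g).toRealLinearIsometryEquiv.norm_map v⟩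
  have htr : ∀ v, F g v = v + F g 0 := fun v => by rw [hρ, hg]; rfl
  have hpow : ∀ n : ℕ, F (g ^ n) 0 = n • F g 0 := by
    intro n
    induction n with
    | zero => simp [hF1]
    | succ n ih => rw [pow_succ', hFmul, IsometryEquiv.mul_apply, htr, ih, succ_nsmul]
  have h0 : F g 0 = 0 := by
    have h1 := hpow (orderOf g)
    rw [pow_orderOf_eq_one, hF1, ← Nat.cast_smul_eq_nsmul ℝ] at h1
    exact (smul_eq_zero.1 h1.symm).resolve_left (Nat.cast_ne_zero.2 (orderOf_pos g).ne')
  have : F g = 1 := IsometryEquiv.ext fun v => by rw [htr, h0, add_zero]; rfl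
  exact e.symm.injective (Subtype.ext (by rw [map_one]; exact this))

/-- A faithful isometric representation without nonzero fixed vectors determines `gcpd` when its
dimension is minimal among the faithful isometric representations. -/
theorem hasGcpd_of_representation [Finite G] {E : Type*} [NormedAddCommGroup E]
    [InnerProductSpace ℝ E] [FiniteDimensional ℝ E] (ρ : Representation ℝ G E)
    (hinj : Function.Injective ρ) (hn : ∀ g v, ‖ρ g v‖ = ‖v‖)
    (hfix : ∀ v, (∀ g, ρ g v = v) → v = 0) (hd : Module.finrank ℝ E = d)
    (hmin : ∀ (e : ℕ) (σ : Representation ℝ G (EuclideanSpace ℝ (Fin e))),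
      Function.Injective σ → (∀ g v, ‖σ g v‖ = ‖v‖) → d ≤ e) : HasGcpd G d := by
  have h := isRealizedFullDim_of_representation ρ hinj hn hfix hd
  have hle : ∀ e, IsRealizedIn G e → d ≤ e := fun e he => by
    obtain ⟨σ, h1, h2⟩ := he.exists_representation
    exact hmin e σ h1 h2
  exact ⟨⟨h.isRealizedIn, hle⟩, ⟨h, fun e he => hle e (IsRealizedFullDim.isRealizedIn he)⟩⟩

end Realization

/-! ### Permutation representations -/

section Permutation

variable {G ι : Type*} [Group G] [Fintype ι] [MulAction G ι]

/-- The permutation representation of `G` on `EuclideanSpace 𝕜 ι`. -/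
noncomputable def permRepresentation (𝕜 : Type*) [RCLike 𝕜] (G ι : Type*) [Group G] [Fintype ι]
    [MulAction G ι] : Representation 𝕜 G (EuclideanSpace 𝕜 ι) where
  toFun g :=
    (LinearIsometryEquiv.piLpCongrLeft 2 𝕜 𝕜 (MulAction.toPerm g)).toLinearEquiv.toLinearMap
  map_one' := by
    ext v i
    simp
  map_mul' g h := by
    ext v i
    simp [mul_smul]

@[simp]
theorem permRepresentation_apply (𝕜 : Type*) [RCLike 𝕜] (g : G) (v : EuclideanSpace 𝕜 ι) (i : ι) :
    permRepresentation 𝕜 G ι g v i = v (g⁻¹ • i) := by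
  simp [permRepresentation]

theorem norm_permRepresentation_apply (𝕜 : Type*) [RCLike 𝕜] (g : G) (v : EuclideanSpace 𝕜 ι) :
    ‖permRepresentation 𝕜 G ι g v‖ = ‖v‖ :=
  (LinearIsometryEquiv.piLpCongrLeft 2 𝕜 𝕜 (MulAction.toPerm g)).norm_map v

/-- The subrepresentation of the permutation representation on the vectors with coordinate sum `0`,
encoded as the orthogonal complement of the all-ones vector. -/
noncomputable def sumZeroSubrepresentation (G ι : Type*) [Group G] [Fintype ι] [MulAction G ι] :
    Subrepresentation (permRepresentation ℝ G ι) where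
  toSubmodule := (Submodule.span ℝ {WithLp.toLp 2 fun _ => (1 : ℝ)})ᗮ
  apply_mem_toSubmodule g v hv := by
    rw [Submodule.mem_orthogonal_singleton_iff_inner_right] at hv ⊢
    simp only [PiLp.inner_apply, permRepresentation_apply] at hv ⊢
    rw [← hv]
    exact Fintype.sum_equiv (MulAction.toPerm g⁻¹) _ _ fun i => rfl

theorem mem_sumZeroSubrepresentation {v : EuclideanSpace ℝ ι} :
    v ∈ (sumZeroSubrepresentation G ι).toSubmodule ↔ ∑ i, v i = 0 := by
  rw [sumZeroSubrepresentation, Submodule.mem_orthogonal_singleton_iff_inner_right]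
  simp [PiLp.inner_apply]

theorem finrank_sumZeroSubrepresentation [Nonempty ι] :
    Module.finrank ℝ (sumZeroSubrepresentation G ι).toSubmodule = Fintype.card ι - 1 := by
  have h := Submodule.finrank_add_finrank_orthogonal
    (Submodule.span ℝ {(WithLp.toLp 2 fun _ => (1 : ℝ) : EuclideanSpace ℝ ι)})
  rw [finrank_span_singleton, finrank_euclideanSpace] at h
  · exact Nat.eq_sub_of_add_eq' h
  · intro h0
    have := congrArg (fun v : EuclideanSpace ℝ ι => v (Classical.arbitrary ι)) h0
    simp at this

theorem sumZeroSubrepresentation_injective [FaithfulSMul G ι] :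
    Function.Injective (sumZeroSubrepresentation G ι).toRepresentation := by
  classical
  refine (injective_iff_map_eq_one _).2 fun g hg => ?_
  refine FaithfulSMul.eq_of_smul_eq_smul (α := ι) fun i => ?_
  rw [one_smul]
  by_contra hne
  -- If `g` moves `i`, then `g` moves the vector `eᵢ - e_j` for `j = g • i`.
  set v : EuclideanSpace ℝ ι := EuclideanSpace.single i 1 - EuclideanSpace.single (g • i) 1
  have hv : v ∈ (sumZeroSubrepresentation G ι).toSubmodule := by
    rw [mem_sumZeroSubrepresentation]
    simp [v]
  have h1 := congrArg Subtype.val (LinearMap.congr_fun hg ⟨v, hv⟩)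
  have h2 : permRepresentation ℝ G ι g v = v := h1
  have h3 := congrArg (fun w : EuclideanSpace ℝ ι => w (g • i)) h2
  simp [v, hne, Ne.symm hne] at h3
  norm_num at h3

theorem sumZeroSubrepresentation_eq_zero [MulAction.IsPretransitive G ι]
    (v : (sumZeroSubrepresentation G ι).toSubmodule)
    (hv : ∀ g, (sumZeroSubrepresentation G ι).toRepresentation g v = v) : v = 0 := by
  have hconst : ∀ i j, v.1 i = v.1 j := by
    intro i j
    obtain ⟨g, rfl⟩ := MulAction.exists_smul_eq G j i
    have h1 : permRepresentation ℝ G ι g v.1 = v.1 := congrArg Subtype.val (hv g)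
    have h2 := congrArg (fun w : EuclideanSpace ℝ ι => w (g • j)) h1
    simpa using h2.symm
  refine Subtype.ext (PiLp.ext fun i => ?_)
  have h := mem_sumZeroSubrepresentation.1 v.2
  rw [Finset.sum_congr rfl fun j _ => hconst j i, Finset.sum_const, nsmul_eq_mul, mul_eq_zero] at h
  have hc : (Finset.univ : Finset ι).card ≠ 0 := (Finset.card_pos.2 ⟨i, Finset.mem_univ i⟩).ne'
  exact h.resolve_left (Nat.cast_ne_zero.2 hc)

/-- A group with a faithful transitive action on `n` points has `gcpd` equal to `n - 1` as soon as
it has no faithful real representation of smaller dimension. -/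
theorem hasGcpd_of_transitive [Finite G] [Nonempty ι] [FaithfulSMul G ι]
    [MulAction.IsPretransitive G ι]
    (hmin : ∀ (e : ℕ) (σ : Representation ℝ G (EuclideanSpace ℝ (Fin e))),
      Function.Injective σ → (∀ g v, ‖σ g v‖ = ‖v‖) → Fintype.card ι - 1 ≤ e) :
    HasGcpd G (Fintype.card ι - 1) :=
  hasGcpd_of_representation (sumZeroSubrepresentation G ι).toRepresentation
    sumZeroSubrepresentation_injective
    (fun g v => norm_permRepresentation_apply ℝ g v.1) sumZeroSubrepresentation_eq_zero
    finrank_sumZeroSubrepresentation hmin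

end Permutation

/-! ### Characters and complexification -/

section Characters

variable {k : Type*} [Field k] {M V ι : Type*} [Monoid M] [AddCommGroup V] [Module k V]

/-- Simultaneous eigenvectors for pairwise distinct characters are linearly independent, by
Dedekind's independence of characters. -/
theorem linearIndependent_of_apply_eq_smul (ρ : Representation k M V) {χ : ι → M →* k}
    (hχ : Function.Injective χ) {w : ι → V} (hw : ∀ i, w i ≠ 0)
    (h : ∀ i m, ρ m (w i) = χ i m • w i) : LinearIndependent k w := by
  rw [linearIndependent_iff']
  intro s c hc i hi
  have hf : ∀ f : Module.Dual k V, c i * f (w i) = 0 := by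
    intro f
    have h1 := (linearIndependent_iff'.1 ((linearIndependent_monoidHom M k).comp χ hχ)) s
      (fun j => c j * f (w j)) (by
        funext m
        have h2 := congrArg (fun v => f (ρ m v)) hc
        simp only [map_sum, map_smul, h, map_zero, smul_eq_mul] at h2
        simp only [Finset.sum_apply, Pi.smul_apply, Function.comp_apply, smul_eq_mul,
          Pi.zero_apply, ← h2]
        exact Finset.sum_congr rfl fun j _ => by ring)
    exact h1 i hi
  by_contra hci
  exact hw i ((Module.forall_dual_apply_eq_zero_iff k _).1 fun f =>
    (mul_eq_zero.1 (hf f)).resolve_left hci)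

end Characters

section Complex

variable {A V : Type*} [AddCommGroup A] [Finite A] [AddCommGroup V] [Module ℂ V]

/-- A nontrivial complex representation of a finite abelian group has an eigenvector for some
nontrivial character: otherwise the projections onto the nontrivial isotypic parts vanish, and by
Fourier inversion every group element acts as the identity. -/
theorem exists_addChar_eigenvector (τ : Representation ℂ (Multiplicative A) V) (hτ : τ ≠ 1) :
    ∃ χ : AddChar A ℂ, χ ≠ 0 ∧ ∃ w, w ≠ 0 ∧ ∀ a, τ (.ofAdd a) w = χ a • w := by
  classical
  have := Fintype.ofFinite A
  by_contra! hcon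
  have hproj : ∀ χ : AddChar A ℂ, χ ≠ 0 → ∀ v, ∑ b, χ (-b) • τ (.ofAdd b) v = 0 := by
    intro χ hχ v
    by_contra hne
    obtain ⟨a, ha⟩ := hcon χ hχ _ hne
    refine ha ?_
    rw [map_sum, Finset.smul_sum]
    refine Fintype.sum_equiv (Equiv.addLeft a) _ _ fun b => ?_
    rw [map_smul, ← Module.End.mul_apply, ← map_mul, ← ofAdd_add, smul_smul, ← AddChar.map_add_eq_mul]
    simp
  have hinv : ∀ a v, (Fintype.card A : ℂ) • τ (.ofAdd a) v = ∑ b, τ (.ofAdd b) v := by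
    intro a v
    have h1 : ∑ χ : AddChar A ℂ, χ a • ∑ b, χ (-b) • τ (.ofAdd b) v =
        ∑ b, τ (.ofAdd b) v := by
      rw [Finset.sum_eq_single 0 (fun χ _ hχ => by rw [hproj χ hχ, smul_zero])
        (fun h => absurd (Finset.mem_univ _) h)]
      simp
    rw [← h1]
    simp only [Finset.smul_sum, smul_smul, ← AddChar.map_add_eq_mul]
    rw [Finset.sum_comm]
    simp only [← Finset.sum_smul, AddChar.sum_apply_eq_ite, ← sub_eq_add_neg, sub_eq_zero, ite_smul,
      zero_smul]
    rw [Finset.sum_ite_eq]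
    simp
  refine hτ (MonoidHom.ext fun a => LinearMap.ext fun v => ?_)
  have h2 := (hinv a.toAdd v).trans (hinv 0 v).symm
  have hc : (Fintype.card A : ℂ) ≠ 0 := Nat.cast_ne_zero.2 Fintype.card_ne_zero
  have h3 := smul_right_injective V hc h2
  simpa using h3

variable {G : Type*} [Group G] {n : ℕ}

/-- The complexification of a real representation, on `ℂⁿ` through the standard basis. -/
noncomputable def Representation.complexify
    (ρ : Representation ℝ G (EuclideanSpace ℝ (Fin n))) : Representation ℂ G (Fin n → ℂ) :=
  (Matrix.toLinAlgEquiv' (R := ℂ) (n := Fin n)).toMonoidHom.comp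
    ((RingHom.mapMatrix (m := Fin n) Complex.ofRealHom).toMonoidHom.comp
      ((LinearMap.toMatrixAlgEquiv (EuclideanSpace.basisFun (Fin n) ℝ).toBasis).toMonoidHom.comp ρ))

theorem Representation.complexify_injective
    {ρ : Representation ℝ G (EuclideanSpace ℝ (Fin n))} (hρ : Function.Injective ρ) :
    Function.Injective ρ.complexify := by
  intro g h hgh
  have h1 := (Matrix.toLinAlgEquiv' (R := ℂ) (n := Fin n)).injective hgh
  have h2 := Matrix.map_injective Complex.ofReal_injective h1
  exact hρ ((LinearMap.toMatrixAlgEquiv (EuclideanSpace.basisFun (Fin n) ℝ).toBasis).injective h2)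

theorem Representation.complexify_apply (ρ : Representation ℝ G (EuclideanSpace ℝ (Fin n))) (g : G)
    (v : Fin n → ℂ) (i : Fin n) : ρ.complexify g v i = ∑ j,
      ((LinearMap.toMatrixAlgEquiv (EuclideanSpace.basisFun (Fin n) ℝ).toBasis (ρ g) i j : ℝ) : ℂ) *
        v j :=
  rfl

theorem Representation.complexify_star (ρ : Representation ℝ G (EuclideanSpace ℝ (Fin n))) (g : G)
    (v : Fin n → ℂ) : ρ.complexify g (star v) = star (ρ.complexify g v) := by
  ext i
  simp only [Pi.star_apply, Representation.complexify_apply, star_sum, star_mul', RCLike.star_def,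
    Complex.conj_ofReal]

end Complex

/-! ### The affine group of degree one -/

section Affine

variable {K : Type*} [Field K]

/-- The translation `x ↦ x + b`, as a homomorphism into the affine group. -/
def affineTranslation (K : Type*) [Field K] : Multiplicative K →* affineGroup K where
  toFun b := ⟨Equiv.addRight b.toAdd, 1, b.toAdd, one_ne_zero, fun x => by simp⟩
  map_one' := Subtype.ext (Equiv.ext fun x => by simp)
  map_mul' b c := Subtype.ext (Equiv.ext fun x => by simp [add_comm, add_left_comm])

/-- The homothety `x ↦ a * x`, as an element of the affine group. -/
def affineHomothety (a : Kˣ) : affineGroup K :=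
  ⟨Equiv.mulLeft₀ (a : K) a.ne_zero, a, 0, a.ne_zero, fun x => by simp⟩

theorem affineTranslation_mul_affineHomothety (b : K) (a : Kˣ) :
    affineTranslation K (.ofAdd b) * affineHomothety a =
      affineHomothety a * affineTranslation K (.ofAdd ((a⁻¹ : Kˣ) * b)) :=
  Subtype.ext (Equiv.ext fun x => by simp [affineTranslation, affineHomothety, mul_add])

theorem affineTranslation_injective : Function.Injective (affineTranslation K) := by
  intro b c h
  have := congrArg (fun f : affineGroup K => f.1 0) h
  simpa [affineTranslation] using this

instance : MulAction.IsPretransitive (affineGroup K) K where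
  exists_smul_eq x y := ⟨affineTranslation K (.ofAdd (y - x)), by
    change x + (y - x) = y
    ring⟩

/-- The homotheties permute the nontrivial characters of the translation group freely, so a
faithful representation contains at least `q - 1` of them. -/
theorem affineGroup_le_of_faithful [Fintype K] {e : ℕ}
    (σ : Representation ℝ (affineGroup K) (EuclideanSpace ℝ (Fin e)))
    (hσ : Function.Injective σ) : Fintype.card K - 1 ≤ e := by
  classical
  have hinj := Representation.complexify_injective hσ
  set ρ := σ.complexify
  obtain ⟨χ, hχ, w, hw0, hw⟩ := exists_addChar_eigenvector (ρ.comp (affineTranslation K)) (by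
    intro h
    have h1 : affineTranslation K (.ofAdd 1) = affineTranslation K (.ofAdd 0) := by
      rw [ofAdd_zero, map_one (affineTranslation K)]
      exact hinj ((DFunLike.congr_fun h _).trans (map_one ρ).symm)
    exact one_ne_zero (α := K) (Multiplicative.ofAdd.injective (affineTranslation_injective h1)))
  have hli := linearIndependent_of_apply_eq_smul (ρ.comp (affineTranslation K))
    (χ := fun a : Kˣ => (χ.mulShift ((a⁻¹ : Kˣ) : K)).toMonoidHom)
    (w := fun a => ρ (affineHomothety a) w) ?_ ?_ ?_
  · have := hli.fintype_card_le_finrank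
    rwa [Module.finrank_fin_fun, Fintype.card_units] at this
  · intro a b hab
    by_contra hne
    refine hχ (DFunLike.ext _ _ fun x => ?_)
    have hd : ((a⁻¹ : Kˣ) : K) - ((b⁻¹ : Kˣ) : K) ≠ 0 := fun h =>
      hne (inv_injective (Units.ext (sub_eq_zero.1 h)))
    have h1 := DFunLike.congr_fun hab (.ofAdd (x / (((a⁻¹ : Kˣ) : K) - ((b⁻¹ : Kˣ) : K))))
    set y := x / (((a⁻¹ : Kˣ) : K) - ((b⁻¹ : Kˣ) : K)) with hy
    have h2 : χ (((a⁻¹ : Kˣ) : K) * y) = χ (((b⁻¹ : Kˣ) : K) * y) := h1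
    have h3 : x = ((a⁻¹ : Kˣ) : K) * y - ((b⁻¹ : Kˣ) : K) * y := by
      rw [← sub_mul, hy]
      field_simp
    rw [h3, sub_eq_add_neg, AddChar.map_add_eq_mul, h2, ← AddChar.map_add_eq_mul]
    simp
  · intro a h0
    refine hw0 ?_
    have := congrArg (ρ (affineHomothety a)⁻¹) h0
    simpa using this
  · intro a b
    have h1 := congrArg (fun g => ρ g w) (affineTranslation_mul_affineHomothety b.toAdd a)
    simp only [map_mul, Module.End.mul_apply] at h1
    have h2 := hw ((a⁻¹ : Kˣ) * b.toAdd)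
    change ρ (affineTranslation K b) _ = _
    simp only [MonoidHom.comp_apply] at h2
    rw [h2, map_smul] at h1
    exact h1

theorem hasGcpd_affineGroup [Finite K] : HasGcpd (affineGroup K) (Nat.card K - 1) := by
  classical
  have := Fintype.ofFinite K
  rw [Nat.card_eq_fintype_card]
  exact hasGcpd_of_transitive fun e σ hσ _ => affineGroup_le_of_faithful σ hσ

end Affine

/-! ### Representations with a faithful central character -/

section Extraspecial

variable {Γ V : Type*} [Group Γ] [AddCommGroup V] [Module ℂ V]

/-- The largest subrepresentation on which the center acts through `χ`. -/
def Representation.centralEigenspace (ρ : Representation ℂ Γ V) (χ : Subgroup.center Γ →* ℂ) :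
    Subrepresentation ρ where
  toSubmodule :=
    { carrier := {v | ∀ z : Subgroup.center Γ, ρ z v = χ z • v}
      add_mem' := fun {v w} hv hw z => by rw [map_add, hv z, hw z, smul_add]
      zero_mem' := fun z => by simp
      smul_mem' := fun c v hv z => by rw [map_smul, hv z, smul_comm] }
  apply_mem_toSubmodule g v hv z := by
    rw [← Module.End.mul_apply, ← map_mul, Subgroup.mem_center_iff.1 z.2 g |>.symm, map_mul,
      Module.End.mul_apply, hv z, map_smul]

open scoped IsMulCommutative in
/-- The character is injective because its kernel is a proper subgroup of a group of prime
order. -/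
theorem Representation.exists_central_character [Finite Γ] {p : ℕ} (hp : p.Prime)
    (hZ : Nat.card (Subgroup.center Γ) = p) (ρ : Representation ℂ Γ V)
    (hρ : Function.Injective ρ) : ∃ χ : Subgroup.center Γ →* ℂ, Function.Injective χ ∧
      (ρ.centralEigenspace χ).toSubmodule ≠ ⊥ := by
  have : Fact (Nat.card (Subgroup.center Γ)).Prime := ⟨hZ.symm ▸ hp⟩
  have hnt : Nontrivial (Subgroup.center Γ) := by
    rw [← Finite.one_lt_card_iff_nontrivial, hZ]
    exact hp.one_lt
  obtain ⟨χ, hχ, w, hw0, hw⟩ := exists_addChar_eigenvector (A := Additive (Subgroup.center Γ))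
    (ρ.comp ((Subgroup.center Γ).subtype.comp
      (MulEquiv.toMultiplicative_toAdditive : _ ≃* Subgroup.center Γ).toMonoidHom)) (by
    intro h
    obtain ⟨z, hz⟩ := exists_ne (1 : Subgroup.center Γ)
    refine hz (Subtype.ext (hρ ?_))
    rw [OneMemClass.coe_one, map_one]
    exact DFunLike.congr_fun h (.ofAdd (.ofMul z)))
  let χ' : Subgroup.center Γ →* ℂ :=
    { toFun := fun z => χ (.ofMul z)
      map_one' := by simp
      map_mul' := fun a b => by rw [ofMul_mul, AddChar.map_add_eq_mul] }
  refine ⟨χ', ?_, fun h => hw0 ?_⟩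
  · rw [injective_iff_map_eq_one]
    intro z hz
    rcases (χ'.ker).eq_bot_or_eq_top_of_prime_card with h | h
    · have : z ∈ χ'.ker := hz
      rwa [h, Subgroup.mem_bot] at this
    · refine absurd (DFunLike.ext _ _ fun a => ?_) hχ
      have : a.toMul ∈ χ'.ker := h ▸ Subgroup.mem_top _
      exact this
  · rw [← Submodule.mem_bot ℂ, ← h]
    exact fun z => hw (.ofMul z)

/-- In a group of nilpotency class at most two, commutators with a fixed element form a
homomorphism into the center. -/
def commutatorHom (hc : ∀ g x : Γ, ⁅g, x⁆ ∈ Subgroup.center Γ) (x : Γ) :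
    Γ →* Subgroup.center Γ where
  toFun g := ⟨⁅g, x⁆, hc g x⟩
  map_one' := Subtype.ext (commutatorElement_one_left x)
  map_mul' g h := Subtype.ext <| by
    have h1 := Subgroup.mem_center_iff.1 (hc h x) g
    have h2 := Subgroup.mem_center_iff.1 (hc h x) ⁅g, x⁆
    simp only [Subgroup.coe_mul]
    rw [h2]
    simp only [commutatorElement_def] at h1 ⊢
    calc g * h * x * (g * h)⁻¹ * x⁻¹ = (g * (h * x * h⁻¹ * x⁻¹)) * x * g⁻¹ * x⁻¹ := by group
      _ = _ := by
        rw [h1]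
        group

theorem mk_eq_mk_of_commutatorHom_eq (hc : ∀ g x : Γ, ⁅g, x⁆ ∈ Subgroup.center Γ) {x y : Γ}
    (h : commutatorHom hc x = commutatorHom hc y) :
    (x : Γ ⧸ Subgroup.center Γ) = y := by
  rw [QuotientGroup.eq, Subgroup.mem_center_iff]
  intro g
  have h1 : ⁅g, x⁆ = ⁅g, y⁆ := congrArg Subtype.val (DFunLike.congr_fun h g)
  have hx : g * x = ⁅g, x⁆ * x * g := by simp [commutatorElement_def]
  have hy : g * y = ⁅g, y⁆ * y * g := by simp [commutatorElement_def]
  have h2 := Subgroup.mem_center_iff.1 (hc g y) x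
  -- `g` acts on `x` and `y` by the same central factor, which cancels in `x⁻¹ * y`.
  have h3 : x * (g * (x⁻¹ * y)) = x * (x⁻¹ * y * g) := by
    have h4 : x * g = ⁅g, y⁆⁻¹ * (g * x) := by rw [hx, h1]; group
    calc x * (g * (x⁻¹ * y)) = (x * g) * x⁻¹ * y := by group
      _ = ⁅g, y⁆⁻¹ * (g * y) := by rw [h4]; group
      _ = x * (x⁻¹ * y * g) := by rw [hy]; group
  exact mul_left_cancel h3

/-- If the center acts by scalars, then `ρ x` is an eigenvector of the conjugation action, with
character `g ↦ χ ⁅g, x⁆`. -/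
theorem Representation.conj_apply_eq_smul (hc : ∀ g x : Γ, ⁅g, x⁆ ∈ Subgroup.center Γ)
    {ρ : Representation ℂ Γ V} {χ : Subgroup.center Γ →* ℂ}
    (hχ : ∀ (z : Subgroup.center Γ) v, ρ z v = χ z • v) (g x : Γ) :
    ρ.linHom ρ g (ρ x) = χ (commutatorHom hc x g) • ρ x := by
  ext v
  have h1 : g * x * g⁻¹ = ⁅g, x⁆ * x := by simp [commutatorElement_def]
  have h2 : ρ g (ρ x (ρ g⁻¹ v)) = ρ ⁅g, x⁆ (ρ x v) := by
    simp only [← Module.End.mul_apply, ← map_mul]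
    rw [← h1, mul_assoc]
  rw [LinearMap.smul_apply, ← hχ]
  exact h2

/-- Operators representing different cosets of the center are eigenvectors for different characters
of the conjugation action, hence linearly independent. -/
theorem Representation.card_quotient_center_le [Finite Γ] [FiniteDimensional ℂ V] [Nontrivial V]
    (hc : ∀ g x : Γ, ⁅g, x⁆ ∈ Subgroup.center Γ)
    {ρ : Representation ℂ Γ V} {χ : Subgroup.center Γ →* ℂ} (hinj : Function.Injective χ)
    (hχ : ∀ (z : Subgroup.center Γ) v, ρ z v = χ z • v) :
    Nat.card (Γ ⧸ Subgroup.center Γ) ≤ Module.finrank ℂ V ^ 2 := by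
  have := Fintype.ofFinite (Γ ⧸ Subgroup.center Γ)
  have hli := linearIndependent_of_apply_eq_smul (ρ.linHom ρ)
    (χ := fun c : Γ ⧸ Subgroup.center Γ => χ.comp (commutatorHom hc c.out))
    (w := fun c => ρ c.out) ?_ ?_ fun c g => conj_apply_eq_smul hc hχ g c.out
  · have := hli.fintype_card_le_finrank
    rwa [Module.finrank_linearMap, ← Nat.card_eq_fintype_card, ← sq] at this
  · intro c d hcd
    have h1 : commutatorHom hc c.out = commutatorHom hc d.out :=
      MonoidHom.ext fun g => hinj (DFunLike.congr_fun hcd g)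
    simpa using mk_eq_mk_of_commutatorHom_eq hc h1
  · intro c h0
    obtain ⟨v, hv⟩ := exists_ne (0 : V)
    refine hv ?_
    have := LinearMap.congr_fun h0 (ρ c.out⁻¹ v)
    simpa using this

/-- Schur's lemma: averaging `T` over the conjugation action gives a scalar, which is determined by
the trace. -/
theorem Representation.sum_conj_eq_smul [Fintype Γ] [FiniteDimensional ℂ V] [Nontrivial V]
    {ρ : Representation ℂ Γ V}
    (hirr : ∀ q : Submodule ℂ V, (∀ g, ∀ v ∈ q, ρ g v ∈ q) → q = ⊥ ∨ q = ⊤)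
    (T : Module.End ℂ V) : ∑ g, ρ g * T * ρ g⁻¹ =
      ((Fintype.card Γ : ℂ) * LinearMap.trace ℂ V T / Module.finrank ℂ V) • 1 := by
  set A := ∑ g, ρ g * T * ρ g⁻¹ with hA
  have hcomm : ∀ h, ρ h * A = A * ρ h := by
    intro h
    rw [hA, Finset.mul_sum, Finset.sum_mul]
    refine Fintype.sum_equiv (Equiv.mulLeft h) _ _ fun g => ?_
    simp only [Equiv.coe_mulLeft, mul_inv_rev, map_mul, mul_assoc]
    rw [← map_mul ρ h⁻¹ h, inv_mul_cancel, map_one, mul_one]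
  obtain ⟨c, hc⟩ := Module.End.exists_eigenvalue A
  have htop : Module.End.eigenspace A c = ⊤ := by
    refine (hirr _ fun g v hv => ?_).resolve_left hc
    rw [Module.End.mem_eigenspace_iff] at hv ⊢
    rw [← Module.End.mul_apply, ← hcomm, Module.End.mul_apply, hv, map_smul]
  have hAc : A = c • 1 := LinearMap.ext fun v =>
    Module.End.mem_eigenspace_iff.1 (htop ▸ Submodule.mem_top : v ∈ Module.End.eigenspace A c)
  have htr : LinearMap.trace ℂ V A = Fintype.card Γ * LinearMap.trace ℂ V T := by
    rw [hA, map_sum]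
    have : ∀ g, LinearMap.trace ℂ V (ρ g * T * ρ g⁻¹) = LinearMap.trace ℂ V T := fun g => by
      rw [LinearMap.trace_mul_comm, ← mul_assoc, ← map_mul, inv_mul_cancel, map_one, one_mul]
    simp [this]
  have hm : (Module.finrank ℂ V : ℂ) ≠ 0 := Nat.cast_ne_zero.2 Module.finrank_pos.ne'
  rw [hAc, map_smul, LinearMap.trace_one, smul_eq_mul] at htr
  rw [hAc, ← htr, mul_div_cancel_right₀ _ hm]

/-- Burnside's theorem, by Schur orthogonality: `∑ g, tr (ρ g⁻¹ * S) • ρ g` is a nonzero multiple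
of `S`. -/
theorem Representation.span_range_eq_top [Finite Γ] [FiniteDimensional ℂ V] [Nontrivial V]
    {ρ : Representation ℂ Γ V}
    (hirr : ∀ q : Submodule ℂ V, (∀ g, ∀ v ∈ q, ρ g v ∈ q) → q = ⊥ ∨ q = ⊤) :
    Submodule.span ℂ (Set.range ρ) = ⊤ := by
  have := Fintype.ofFinite Γ
  refine eq_top_iff.2 fun S _ => ?_
  set b := Module.finBasis ℂ V
  set r : ℂ := (Fintype.card Γ : ℂ) / Module.finrank ℂ V
  have hr : r ≠ 0 := div_ne_zero (Nat.cast_ne_zero.2 Fintype.card_ne_zero)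
    (Nat.cast_ne_zero.2 Module.finrank_pos.ne')
  have key : ∑ g, LinearMap.trace ℂ V (ρ g⁻¹ * S) • ρ g = r • S := by
    refine LinearMap.ext fun w => ?_
    have h1 : ∀ i, ∑ g, b.repr (ρ g⁻¹ (S (b i))) i • ρ g w = (r * b.repr w i) • S (b i) := by
      intro i
      have h2 := LinearMap.congr_fun
        (sum_conj_eq_smul hirr ((b.coord i).smulRight w)) (S (b i))
      simp only [LinearMap.sum_apply, Module.End.mul_apply, LinearMap.smulRight_apply, map_smul,
        Module.Basis.coord_apply, LinearMap.smul_apply, Module.End.one_apply,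
        LinearMap.trace_smulRight] at h2
      rw [h2]
      congr 1
      ring
    calc (∑ g, LinearMap.trace ℂ V (ρ g⁻¹ * S) • ρ g) w
        = ∑ i, ∑ g, b.repr (ρ g⁻¹ (S (b i))) i • ρ g w := by
          rw [Finset.sum_comm, LinearMap.sum_apply]
          refine Finset.sum_congr rfl fun g _ => ?_
          rw [LinearMap.smul_apply, LinearMap.trace_eq_matrix_trace ℂ b, Matrix.trace,
            Finset.sum_smul]
          simp [LinearMap.toMatrix_apply]
      _ = r • S w := by
          simp only [h1, mul_smul, ← Finset.smul_sum]
          conv_rhs => rw [← b.sum_repr w]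
          simp only [map_sum, map_smul]
  rw [← inv_smul_smul₀ hr S, ← key]
  exact Submodule.smul_mem _ _ (Submodule.sum_mem _ fun g _ =>
    Submodule.smul_mem _ _ (Submodule.subset_span ⟨g, rfl⟩))

/-- The operators `ρ g` span the endomorphisms, and up to scalars there are only as many of them as
there are cosets of the center. -/
theorem Representation.finrank_sq_le_card_quotient_center [Finite Γ] [FiniteDimensional ℂ V]
    [Nontrivial V] {ρ : Representation ℂ Γ V}
    (hirr : ∀ q : Submodule ℂ V, (∀ g, ∀ v ∈ q, ρ g v ∈ q) → q = ⊥ ∨ q = ⊤)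
    {χ : Subgroup.center Γ →* ℂ} (hχ : ∀ (z : Subgroup.center Γ) v, ρ z v = χ z • v) :
    Module.finrank ℂ V ^ 2 ≤ Nat.card (Γ ⧸ Subgroup.center Γ) := by
  have := Fintype.ofFinite (Γ ⧸ Subgroup.center Γ)
  have htop : Submodule.span ℂ (Set.range fun c : Γ ⧸ Subgroup.center Γ => ρ c.out) = ⊤ := by
    rw [eq_top_iff, ← span_range_eq_top hirr, Submodule.span_le]
    rintro _ ⟨g, rfl⟩
    obtain ⟨z, hz⟩ := QuotientGroup.mk_out_eq_mul (Subgroup.center Γ) g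
    have h1 : ρ g = χ z⁻¹ • ρ (g : Γ ⧸ Subgroup.center Γ).out := by
      refine LinearMap.ext fun v => ?_
      rw [LinearMap.smul_apply, ← hχ, ← Module.End.mul_apply, ← map_mul, hz,
        Subgroup.mem_center_iff.1 z.2 g]
      simp
    rw [h1]
    exact Submodule.smul_mem _ _ (Submodule.subset_span ⟨_, rfl⟩)
  have h := finrank_range_le_card (R := ℂ) fun c : Γ ⧸ Subgroup.center Γ => ρ c.out
  rwa [Set.finrank, htop, finrank_top, Module.finrank_linearMap, ← sq,
    ← Nat.card_eq_fintype_card] at h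

theorem Representation.exists_irreducible_le [FiniteDimensional ℂ V] {ρ : Representation ℂ Γ V}
    (σ : Subrepresentation ρ) (hσ : σ.toSubmodule ≠ ⊥) :
    ∃ τ : Subrepresentation ρ, τ.toSubmodule ≤ σ.toSubmodule ∧ τ.toSubmodule ≠ ⊥ ∧
      ∀ q : Submodule ℂ τ.toSubmodule, (∀ g, ∀ v ∈ q, τ.toRepresentation g v ∈ q) →
        q = ⊥ ∨ q = ⊤ := by
  obtain ⟨p, ⟨hp0, hpσ, hpρ⟩, hmin⟩ := wellFounded_lt.has_min
    {p : Submodule ℂ V | p ≠ ⊥ ∧ p ≤ σ.toSubmodule ∧ ∀ g, ∀ v ∈ p, ρ g v ∈ p}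
    ⟨σ.toSubmodule, hσ, le_rfl, fun g v hv => σ.apply_mem_toSubmodule g hv⟩
  refine ⟨⟨p, fun g v hv => hpρ g v hv⟩, hpσ, hp0, fun q hq => or_iff_not_imp_left.2 fun hq0 => ?_⟩
  have hle : q.map p.subtype ≤ p := Submodule.map_subtype_le p q
  have hmem : ¬ q.map p.subtype < p := hmin _ ⟨fun h => hq0 ?_, hle.trans hpσ, ?_⟩
  · have heq := hle.eq_of_not_lt hmem
    refine eq_top_iff.2 fun v _ => ?_
    obtain ⟨w, hw, hwv⟩ := heq.ge v.2
    rwa [← Subtype.ext hwv]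
  · exact Submodule.map_injective_of_injective p.subtype_injective (h.trans (Submodule.map_bot _).symm)
  · rintro g _ ⟨v, hv, rfl⟩
    exact ⟨_, hq g v hv, rfl⟩

end Extraspecial

/-! ### Extraspecial groups -/

section Extraspecial

variable {Γ : Type*} [Group Γ] {p k : ℕ}

theorem IsExtraspecial.commutator_mem_center (h : IsExtraspecial p Γ) (g x : Γ) :
    ⁅g, x⁆ ∈ Subgroup.center Γ := by
  rw [← h.commutator_eq_center]
  exact Subgroup.commutator_mem_commutator (Subgroup.mem_top g) (Subgroup.mem_top x)

theorem IsExtraspecial.card_quotient_center (hp : p.Prime) (h : IsExtraspecial p Γ)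
    (hcard : Nat.card Γ = p ^ (2 * k + 1)) : Nat.card (Γ ⧸ Subgroup.center Γ) = (p ^ k) ^ 2 := by
  have h1 := (Subgroup.center Γ).card_eq_card_quotient_mul_card_subgroup
  rw [hcard, h.card_center, pow_succ] at h1
  rw [← pow_mul, mul_comm k 2]
  exact (Nat.eq_of_mul_eq_mul_right hp.pos h1).symm

theorem IsExtraspecial.pow_le_finrank_centralEigenspace [Finite Γ] (hp : p.Prime)
    (h : IsExtraspecial p Γ) (hcard : Nat.card Γ = p ^ (2 * k + 1)) {V : Type*} [AddCommGroup V]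
    [Module ℂ V] [FiniteDimensional ℂ V] {ρ : Representation ℂ Γ V} {χ : Subgroup.center Γ →* ℂ}
    (hinj : Function.Injective χ) (hne : (ρ.centralEigenspace χ).toSubmodule ≠ ⊥) :
    p ^ k ≤ Module.finrank ℂ (ρ.centralEigenspace χ).toSubmodule := by
  have : Nontrivial (ρ.centralEigenspace χ).toSubmodule := Submodule.nontrivial_iff_ne_bot.2 hne
  have h1 := Representation.card_quotient_center_le h.commutator_mem_center
    (ρ := (ρ.centralEigenspace χ).toRepresentation) hinj fun z v => Subtype.ext (v.2 z)
  rw [h.card_quotient_center hp hcard] at h1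
  exact (Nat.pow_le_pow_iff_left two_ne_zero).1 h1

/-- In the complexification of a real representation, a central character `χ` occurs together with
its complex conjugate, and these differ because the center has odd order. -/
theorem IsExtraspecial.le_of_faithful [Finite Γ] (hp : p.Prime) (hodd : Odd p)
    (h : IsExtraspecial p Γ) (hcard : Nat.card Γ = p ^ (2 * k + 1)) {e : ℕ}
    (σ : Representation ℝ Γ (EuclideanSpace ℝ (Fin e))) (hσ : Function.Injective σ) :
    2 * p ^ k ≤ e := by
  obtain ⟨χ, hinj, hne⟩ := Representation.exists_central_character hp h.card_center _
    (Representation.complexify_injective hσ)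
  let χ' : Subgroup.center Γ →* ℂ := (starRingEnd ℂ).toMonoidHom.comp χ
  have hinj' : Function.Injective χ' := (starRingEnd ℂ).injective.comp hinj
  have hne' : (σ.complexify.centralEigenspace χ').toSubmodule ≠ ⊥ := by
    obtain ⟨v, hv, hv0⟩ := Submodule.exists_mem_ne_zero_of_ne_bot hne
    refine Submodule.ne_bot_iff _ |>.2 ⟨star v, fun z => ?_, star_ne_zero.2 hv0⟩
    rw [Representation.complexify_star, hv z, star_smul]
    rfl
  obtain ⟨z, hz⟩ : ∃ z, χ z ≠ χ' z := by
    by_contra! hcon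
    have : Nontrivial (Subgroup.center Γ) := by
      rw [← Finite.one_lt_card_iff_nontrivial, h.card_center]
      exact hp.one_lt
    obtain ⟨z, hz⟩ := exists_ne (1 : Subgroup.center Γ)
    -- A real root of unity of odd order is `1`.
    have hpow : χ z ^ p = 1 := by rw [← map_pow, ← h.card_center, pow_card_eq_one', map_one]
    obtain ⟨r, hr⟩ := Complex.conj_eq_iff_real.1 (hcon z).symm
    rw [hr, ← Complex.ofReal_pow, Complex.ofReal_eq_one] at hpow
    have hr1 : r = 1 := hodd.strictMono_pow.injective (by simpa using hpow)
    exact hz (hinj (by rw [hr, hr1, map_one, Complex.ofReal_one]))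
  have hdisj : Disjoint (σ.complexify.centralEigenspace χ).toSubmodule
      (σ.complexify.centralEigenspace χ').toSubmodule := by
    rw [Submodule.disjoint_def]
    intro v hv hv'
    have h1 := (hv z).symm.trans (hv' z)
    rw [← sub_eq_zero, ← sub_smul] at h1
    exact (smul_eq_zero.1 h1).resolve_left (sub_ne_zero.2 hz)
  have h1 := h.pow_le_finrank_centralEigenspace hp hcard hinj hne
  have h2 := h.pow_le_finrank_centralEigenspace hp hcard hinj' hne'
  have h3 := Submodule.finrank_add_finrank_le_of_disjoint hdisj
  rw [Module.finrank_fin_fun] at h3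
  omega

/-- The polytope lives in the underlying real space of an irreducible subrepresentation, of complex
dimension `p ^ k`, of the complex regular representation. -/
theorem hasGcpd_of_isExtraspecial (hp : p.Prime) (hodd : Odd p) (h : IsExtraspecial p Γ)
    (hcard : Nat.card Γ = p ^ (2 * k + 1)) : HasGcpd Γ (2 * p ^ k) := by
  have : Finite Γ := Nat.finite_of_card_ne_zero (by rw [hcard]; exact (pow_pos hp.pos _).ne')
  have := Fintype.ofFinite Γ
  have hfaith : Function.Injective (permRepresentation ℂ Γ Γ) := by
    classical
    intro g g' hgg'
    have h1 := congrArg (fun v : EuclideanSpace ℂ Γ => v g)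
      (LinearMap.congr_fun hgg' (EuclideanSpace.single 1 1))
    simpa [Pi.single_apply, inv_mul_eq_one, eq_comm] using h1
  obtain ⟨χ, hinj, hne⟩ := Representation.exists_central_character hp h.card_center _ hfaith
  obtain ⟨τ, hτ, hτ0, hirr⟩ := Representation.exists_irreducible_le _ hne
  have hχ : ∀ (z : Subgroup.center Γ) v, τ.toRepresentation z v = χ z • v := fun z v =>
    Subtype.ext (hτ v.2 z)
  have : Nontrivial τ.toSubmodule := Submodule.nontrivial_iff_ne_bot.2 hτ0
  have hdim : Module.finrank ℂ τ.toSubmodule = p ^ k := by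
    have h1 := Representation.card_quotient_center_le h.commutator_mem_center hinj hχ
    have h2 := Representation.finrank_sq_le_card_quotient_center hirr hχ
    rw [h.card_quotient_center hp hcard] at h1 h2
    exact Nat.pow_left_injective two_ne_zero (le_antisymm h2 h1)
  have hχ1 : ∀ z : Subgroup.center Γ, (∃ v, v ≠ 0 ∧ τ.toRepresentation z v = v) → z = 1 := by
    rintro z ⟨v, hv0, hv⟩
    rw [hχ, ← sub_eq_zero] at hv
    nth_rw 2 [← one_smul ℂ v] at hv
    rw [← sub_smul] at hv
    have := (smul_eq_zero.1 hv).resolve_right hv0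
    exact hinj (by rw [sub_eq_zero.1 this, map_one])
  obtain ⟨v₀, hv₀⟩ := exists_ne (0 : τ.toSubmodule)
  have hinjτ : Function.Injective τ.toRepresentation := by
    refine (injective_iff_map_eq_one _).2 fun g hg => ?_
    have hgZ : g ∈ Subgroup.center Γ := by
      refine Subgroup.mem_center_iff.2 fun x => ?_
      have hg' : τ.toRepresentation g⁻¹ = 1 := by
        have h1 := map_mul τ.toRepresentation g⁻¹ g
        rwa [hg, mul_one, inv_mul_cancel, map_one, eq_comm] at h1
      have hx : τ.toRepresentation ⁅x, g⁆ = 1 := by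
        rw [commutatorElement_def, map_mul, hg', mul_one, map_mul, map_mul, hg, mul_one,
          ← map_mul, mul_inv_cancel, map_one]
      have h1 := hχ1 ⟨⁅x, g⁆, h.commutator_mem_center x g⟩ ⟨v₀, hv₀, LinearMap.congr_fun hx v₀⟩
      exact commutatorElement_eq_one_iff_mul_comm.1 (congrArg Subtype.val h1)
    exact congrArg Subtype.val (hχ1 ⟨g, hgZ⟩ ⟨v₀, hv₀, by rw [hg, Module.End.one_apply]⟩)
  let _ : InnerProductSpace ℝ τ.toSubmodule := InnerProductSpace.rclikeToReal ℂ τ.toSubmodule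
  let σ : Representation ℝ Γ τ.toSubmodule :=
    { toFun := fun g => (τ.toRepresentation g).restrictScalars ℝ
      map_one' := by
        rw [map_one]
        rfl
      map_mul' := fun g g' => by
        rw [map_mul]
        rfl }
  refine hasGcpd_of_representation σ (fun g g' hgg' => hinjτ ?_)
    (fun g v => norm_permRepresentation_apply ℂ g v.1) (fun v hv => ?_) ?_
    fun e ρ hρ _ => h.le_of_faithful hp hodd hcard ρ hρ
  · exact LinearMap.ext fun v => LinearMap.congr_fun hgg' v
  · by_contra hv0
    have : Nontrivial (Subgroup.center Γ) := by
      rw [← Finite.one_lt_card_iff_nontrivial, h.card_center]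
      exact hp.one_lt
    obtain ⟨z, hz⟩ := exists_ne (1 : Subgroup.center Γ)
    exact hz (hχ1 z ⟨v, hv0, hv z⟩)
  · rw [finrank_real_of_complex, hdim]

end Extraspecial

/-! ### Reflections -/

section Reflection

variable {E : Type*} [NormedAddCommGroup E] [InnerProductSpace ℝ E]

/-- The operator `T` is the orthogonal reflection in the hyperplane normal to the unit vector
`u`. -/
structure IsReflectionAlong (T : E →ₗ[ℝ] E) (u : E) : Prop where
  norm_eq : ‖u‖ = 1
  apply_eq : ∀ v, T v = v - (2 * ⟪u, v⟫) • u

/-- Two reflections agree exactly when their unit normals agree up to sign. -/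
theorem IsReflectionAlong.inner_sq_eq_one_iff {S T : E →ₗ[ℝ] E} {u w : E}
    (hS : IsReflectionAlong S u) (hT : IsReflectionAlong T w) : ⟪u, w⟫ ^ 2 = 1 ↔ S = T := by
  have huu : ⟪u, u⟫ = 1 := by rw [real_inner_self_eq_norm_sq, hS.norm_eq, one_pow]
  have hww : ⟪w, w⟫ = 1 := by rw [real_inner_self_eq_norm_sq, hT.norm_eq, one_pow]
  constructor
  · intro h
    have hw : w = ⟪u, w⟫ • u := by
      rw [← sub_eq_zero, ← inner_self_eq_zero (𝕜 := ℝ)]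
      simp only [inner_sub_left, inner_sub_right, inner_smul_left, inner_smul_right, hww, huu,
        real_inner_comm u w, conj_trivial]
      linarith
    refine LinearMap.ext fun v => ?_
    rw [hS.apply_eq, hT.apply_eq, hw, inner_smul_left, smul_smul, conj_trivial,
      show 2 * (⟪u, w⟫ * ⟪u, v⟫) * ⟪u, w⟫ = ⟪u, w⟫ ^ 2 * (2 * ⟪u, v⟫) by ring, h, one_mul]
  · rintro rfl
    have h1 := (hS.apply_eq w).symm.trans (hT.apply_eq w)
    have h2 := congrArg (fun v => ⟪w, v⟫) h1
    simp only [inner_sub_right, inner_smul_right, hww, real_inner_comm u w] at h2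
    linarith

theorem IsReflectionAlong.of_finrank_eq_one {T : E →ₗ[ℝ] E} (hn : ∀ v, ‖T v‖ = ‖v‖)
    (hT : ∀ v, T (T v) = v) (h : Module.finrank ℝ (Module.End.eigenspace T (-1)) = 1) :
    ∃ u, IsReflectionAlong T u := by
  obtain ⟨w, hw0, hw⟩ := finrank_eq_one_iff'.1 h
  have hw0' : ‖w.1‖ ≠ 0 := norm_ne_zero_iff.2 fun h => hw0 (Subtype.ext h)
  have hTw : T w.1 = -w.1 := by simpa using Module.End.mem_eigenspace_iff.1 w.2
  set u := ‖w.1‖⁻¹ • w.1 with hu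
  have hTu : T u = -u := by rw [hu, map_smul, hTw, smul_neg]
  have hu1 : ‖u‖ = 1 := by rw [hu, norm_smul, norm_inv, norm_norm, inv_mul_cancel₀ hw0']
  refine ⟨u, hu1, fun v => ?_⟩
  obtain ⟨c, hc⟩ := hw ⟨v - T v, by rw [Module.End.mem_eigenspace_iff, map_sub, hT]; simp⟩
  have hc : v - T v = (c * ‖w.1‖) • u := by
    rw [hu, smul_smul, mul_assoc, mul_inv_cancel₀ hw0', mul_one]
    exact (congrArg Subtype.val hc).symm
  have h1 : ⟪u, T v⟫ = -⟪u, v⟫ := by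
    have h2 := LinearIsometry.inner_map_map (⟨T, hn⟩ : E →ₗᵢ[ℝ] E) u v
    change ⟪T u, T v⟫ = _ at h2
    rw [hTu, inner_neg_left] at h2
    linarith
  have h2 := congrArg (fun v => ⟪u, v⟫) hc
  simp only [inner_sub_right, h1, inner_smul_right, real_inner_self_eq_norm_sq, hu1] at h2
  rw [show 2 * ⟪u, v⟫ = c * ‖w.1‖ by linarith, ← hc]
  abel

variable {G : Type*} [Group G]

theorem IsReflectionAlong.conj {ρ : Representation ℝ G E} (hn : ∀ g v, ‖ρ g v‖ = ‖v‖) {s : G}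
    {u : E} (h : IsReflectionAlong (ρ s) u) (g : G) :
    IsReflectionAlong (ρ (g * s * g⁻¹)) (ρ g u) := by
  refine ⟨by rw [hn, h.norm_eq], fun v => ?_⟩
  have h1 : ⟪u, ρ g⁻¹ v⟫ = ⟪ρ g u, v⟫ := by
    rw [← Representation.inner_apply_apply hn g]
    simp
  rw [map_mul, map_mul, Module.End.mul_apply, Module.End.mul_apply, h.apply_eq, map_sub, map_smul,
    h1]
  simp

end Reflection

/-! ### Symmetric groups generated by reflections -/

section SymmetricGroup

open Equiv

variable {α : Type*} [DecidableEq α] {E : Type*} [NormedAddCommGroup E] [InnerProductSpace ℝ E]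
  {ρ : Representation ℝ (Perm α) E}

theorem Representation.map_swap_eq_map_swap_of_conj {a b c d : α}
    (h : ρ (swap a b) = ρ (swap c d)) (g : Perm α) :
    ρ (swap (g a) (g b)) = ρ (swap (g c) (g d)) := by
  rw [swap_apply_apply, swap_apply_apply, map_mul, map_mul, h, ← map_mul, ← map_mul]

/-- The representation does not identify disjoint transpositions; equivalently, products of two
disjoint transpositions act nontrivially. -/
def SeparatesDisjointSwaps (ρ : Representation ℝ (Perm α) E) : Prop :=
  ∃ x : Fin 4 → α, Function.Injective x ∧ ρ (swap (x 0) (x 1)) ≠ ρ (swap (x 2) (x 3))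

theorem SeparatesDisjointSwaps.map_swap_ne_of_disjoint (h : SeparatesDisjointSwaps ρ)
    {y : Fin 4 → α} (hy : Function.Injective y) :
    ρ (swap (y 0) (y 1)) ≠ ρ (swap (y 2) (y 3)) := by
  obtain ⟨x, hx, hne⟩ := h
  intro heq
  obtain ⟨g, hg⟩ := Perm.exists_extending_pair y x hy hx
  have := Representation.map_swap_eq_map_swap_of_conj heq g
  simp only [hg] at this
  exact hne this

/-- If `(a b)` and `(a c)` acted alike, so would all pairs of transpositions with a common point, and
hence all transpositions. -/
theorem SeparatesDisjointSwaps.map_swap_ne (h : SeparatesDisjointSwaps ρ) {a b c : α}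
    (hab : a ≠ b) (hac : a ≠ c) (hbc : b ≠ c) : ρ (swap a b) ≠ ρ (swap a c) := by
  intro heq
  have key : ∀ x y z : α, x ≠ y → x ≠ z → y ≠ z → ρ (swap x y) = ρ (swap x z) := by
    intro x y z hxy hxz hyz
    have hi : ∀ {p q r : α}, p ≠ q → p ≠ r → q ≠ r → Function.Injective ![p, q, r] := by
      intro p q r h1 h2 h3 i j hij
      fin_cases i <;> fin_cases j <;> simp_all
    obtain ⟨g, hg⟩ := Perm.exists_extending_pair _ _ (hi hab hac hbc) (hi hxy hxz hyz)
    have h0 : g a = x := by simpa using hg 0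
    have h1 : g b = y := by simpa using hg 1
    have h2 : g c = z := by simpa using hg 2
    have := Representation.map_swap_eq_map_swap_of_conj heq g
    rwa [h0, h1, h2] at this
  obtain ⟨x, hx, hne⟩ := h
  refine hne ?_
  rw [key (x 0) (x 1) (x 2) (hx.ne (by decide)) (hx.ne (by decide)) (hx.ne (by decide)),
    swap_comm (x 0) (x 2),
    key (x 2) (x 0) (x 3) (hx.ne (by decide)) (hx.ne (by decide)) (hx.ne (by decide))]

/-- If the transpositions act as reflections, the unit normals of the transpositions
`(x₀ x)`, `x ≠ x₀`, have Gram matrix `(1 + J) / 2` up to signs, with `J` the all-ones matrix, and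
hence are linearly independent. -/
theorem SeparatesDisjointSwaps.card_sub_one_le_of_isReflectionAlong [Fintype α] [FiniteDimensional ℝ E]
    (h : SeparatesDisjointSwaps ρ) (hn : ∀ g v, ‖ρ g v‖ = ‖v‖)
    (hr : ∀ a b : α, a ≠ b → ∃ u, IsReflectionAlong (ρ (swap a b)) u) :
    Fintype.card α - 1 ≤ Module.finrank ℝ E := by
  obtain ⟨x, hx, -⟩ := id h
  set o := x 0
  choose β hβ using fun y : {y // y ≠ o} => hr o y y.2.symm
  have hself : ∀ y, ⟪β y, β y⟫ = 1 := fun y => by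
    rw [real_inner_self_eq_norm_sq, (hβ y).norm_eq, one_pow]
  have hroot : ∀ y z, y ≠ z →
      IsReflectionAlong (ρ (swap y.1 z.1)) (β z - (2 * ⟪β y, β z⟫) • β y) := by
    intro y z hyz
    have h1 := (hβ z).conj hn (swap o y.1)
    rwa [← swap_apply_apply, swap_apply_left,
      swap_apply_of_ne_of_ne z.2 (fun h => hyz (Subtype.ext h.symm)), (hβ y).apply_eq] at h1
  have hquarter : ∀ y z, y ≠ z → ⟪β y, β z⟫ ^ 2 = 1 / 4 := by
    intro y z hyz
    have h1 := hroot y z hyz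
    have h2 := hroot z y hyz.symm
    rw [swap_comm, real_inner_comm] at h2
    have h3 := (h1.inner_sq_eq_one_iff h2).2 rfl
    have h4 : ⟪β y, β z⟫ ^ 2 ≠ 1 := fun h5 =>
      h.map_swap_ne y.2.symm z.2.symm (fun h => hyz (Subtype.ext h))
        (((hβ y).inner_sq_eq_one_iff (hβ z)).1 h5)
    simp only [inner_sub_left, inner_sub_right, inner_smul_left, inner_smul_right, hself,
      conj_trivial, real_inner_comm (β y) (β z)] at h3
    set c := ⟪β y, β z⟫
    -- With `c = cos θ`, the inner product of the two normals is `cos (3 θ)`.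
    have h5 : (c ^ 2 - 1) * (4 * c ^ 2 - 1) ^ 2 = 0 := by linear_combination h3
    have h6 := pow_eq_zero_iff two_ne_zero |>.1
      ((mul_eq_zero.1 h5).resolve_left (sub_ne_zero.2 h4))
    linarith
  have htriple : ∀ y z w, y ≠ z → y ≠ w → z ≠ w →
      ⟪β w, β z⟫ = 2 * ⟪β y, β z⟫ * ⟪β w, β y⟫ := by
    intro y z w hyz hyw hzw
    have h1 := hroot y z hyz
    set r := β z - (2 * ⟪β y, β z⟫) • β y with hr
    have h2 := h1.conj hn (swap o w.1)
    have hne : ∀ {a b : {y // y ≠ o}}, a ≠ b → a.1 ≠ b.1 := fun h h' => h (Subtype.ext h')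
    rw [← swap_apply_apply, swap_apply_of_ne_of_ne y.2 (hne hyw),
      swap_apply_of_ne_of_ne z.2 (hne hzw), (hβ w).apply_eq] at h2
    have h3 := (h1.inner_sq_eq_one_iff h2).2 rfl
    have h4 : ⟪β w, r⟫ ^ 2 ≠ 1 := fun h5 => by
      refine h.map_swap_ne_of_disjoint (y := ![o, w.1, y.1, z.1]) ?_
        (((hβ w).inner_sq_eq_one_iff h1).1 h5)
      have := y.2
      have := z.2
      have := w.2
      have := hne hyz
      have := hne hyw
      have := hne hzw
      intro i j hij
      fin_cases i <;> fin_cases j <;> simp_all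
    have hrr : ⟪r, r⟫ = 1 := by rw [real_inner_self_eq_norm_sq, h1.norm_eq, one_pow]
    simp only [inner_sub_right, inner_smul_right, hrr, real_inner_comm (β w) r] at h3
    set e := ⟪β w, r⟫ with he
    -- Conjugating `(y z)` by the disjoint transposition `(o w)` fixes its normal `r` up to sign.
    have h5 : (e ^ 2 - 1) * e ^ 2 = 0 := by linear_combination h3 / 4
    have h6 := pow_eq_zero_iff two_ne_zero |>.1
      ((mul_eq_zero.1 h5).resolve_left (sub_ne_zero.2 h4))
    rw [he, hr, inner_sub_right, inner_smul_right] at h6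
    linarith
  set m : {y // y ≠ o} := ⟨x 1, hx.ne (by decide)⟩
  set ε : {y // y ≠ o} → ℝ := fun y => if y = m then 1 else 2 * ⟪β m, β y⟫ with hε
  have hεsq : ∀ y, ε y * ε y = 1 := by
    intro y
    by_cases hy : y = m
    · simp [hε, hy]
    · have := hquarter m y (Ne.symm hy)
      simp only [hε, hy, if_false]
      linarith
  have hgram : ∀ y z, y ≠ z → ⟪β y, β z⟫ = ε y * ε z / 2 := by
    intro y z hyz
    by_cases hy : y = m
    · subst hy
      simp [hε, hyz.symm]
    · by_cases hz : z = m
      · subst hz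
        simp [hε, hyz, real_inner_comm]
      · rw [htriple m z y (Ne.symm hz) (Ne.symm hy) hyz.symm, real_inner_comm (β m) (β y)]
        simp only [hε, hy, hz, if_false]
        ring
  have hli : LinearIndependent ℝ β := by
    rw [Fintype.linearIndependent_iff]
    intro c hc
    set S := ∑ y, c y * ε y with hS
    have h1 : ∀ z, c z = -(ε z * S) := by
      intro z
      have h2 := congrArg (fun v => ⟪β z, v⟫) hc
      simp only [inner_sum, inner_smul_right, inner_zero_right] at h2
      have h3 : ∀ y, c y * ⟪β z, β y⟫ = ε z / 2 * (c y * ε y) + if y = z then c y / 2 else 0 := by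
        intro y
        by_cases hyz : y = z
        · subst hyz
          rw [hself, if_pos rfl]
          linear_combination (-c y / 2) * hεsq y
        · rw [hgram z y (Ne.symm hyz), if_neg hyz]
          ring
      rw [Finset.sum_congr rfl fun y _ => h3 y, Finset.sum_add_distrib, ← Finset.mul_sum, ← hS,
        Finset.sum_ite_eq' Finset.univ z] at h2
      simp only [Finset.mem_univ, if_true] at h2
      linarith
    have hS0 : S = 0 := by
      have h2 : S = ∑ _y : {y // y ≠ o}, -S := by
        nth_rw 1 [hS]
        refine Finset.sum_congr rfl fun y _ => ?_
        rw [h1 y]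
        linear_combination (-S) * hεsq y
      rw [Finset.sum_const, nsmul_eq_mul] at h2
      have h3 : (0 : ℝ) ≤ (Finset.univ : Finset {y // y ≠ o}).card := Nat.cast_nonneg _
      have h4 : (1 + ((Finset.univ : Finset {y // y ≠ o}).card : ℝ)) * S = 0 := by linarith
      exact (mul_eq_zero.1 h4).resolve_left (by linarith)
    intro y
    rw [h1 y, hS0, mul_zero, neg_zero]
  have := hli.fintype_card_le_finrank
  rwa [Fintype.card_subtype_compl, Fintype.card_subtype_eq] at this

end SymmetricGroup

/-! ### The minimal faithful dimension of the symmetric group -/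

section SymmetricGroup

open Equiv

variable {α : Type*} [DecidableEq α] {E : Type*} [NormedAddCommGroup E] [InnerProductSpace ℝ E]
  {ρ : Representation ℝ (Perm α) E}

/-- The tensor product of a representation of the symmetric group with the sign character. -/
noncomputable def signTwist [Fintype α] (ρ : Representation ℝ (Perm α) E) :
    Representation ℝ (Perm α) E where
  toFun g := ((Perm.sign g : ℤ) : ℝ) • ρ g
  map_one' := by simp
  map_mul' g h := by
    simp only [map_mul, Units.val_mul, Int.cast_mul, smul_mul_smul_comm]

theorem signTwist_swap [Fintype α] {a b : α} (hab : a ≠ b) :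
    signTwist ρ (swap a b) = -ρ (swap a b) := by
  change ((Perm.sign (swap a b) : ℤ) : ℝ) • ρ (swap a b) = _
  simp [Perm.sign_swap hab]

theorem norm_signTwist_apply [Fintype α] (hn : ∀ g v, ‖ρ g v‖ = ‖v‖) (g : Perm α) (v : E) :
    ‖signTwist ρ g v‖ = ‖v‖ := by
  change ‖((Perm.sign g : ℤ) : ℝ) • ρ g v‖ = ‖v‖
  rcases Int.units_eq_one_or (Perm.sign g) with h | h <;> simp [h, hn]

theorem SeparatesDisjointSwaps.signTwist [Fintype α] (h : SeparatesDisjointSwaps ρ) :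
    SeparatesDisjointSwaps (signTwist ρ) := by
  obtain ⟨x, hx, hne⟩ := h
  refine ⟨x, hx, ?_⟩
  rw [signTwist_swap (hx.ne (by decide)), signTwist_swap (hx.ne (by decide))]
  exact fun h => hne (neg_injective h)

theorem Representation.apply_swap_apply_swap (ρ : Representation ℝ (Perm α) E) (a b : α) (v : E) :
    ρ (swap a b) (ρ (swap a b) v) = v := by
  rw [← Module.End.mul_apply, ← map_mul, swap_mul_self, map_one, Module.End.one_apply]

theorem SeparatesDisjointSwaps.card_sub_one_le_of_finrank_eq_one [Fintype α]
    [FiniteDimensional ℝ E] (h : SeparatesDisjointSwaps ρ) (hn : ∀ g v, ‖ρ g v‖ = ‖v‖) {a b : α}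
    (hab : a ≠ b) (h1 : Module.finrank ℝ (Module.End.eigenspace (ρ (swap a b)) (-1)) = 1) :
    Fintype.card α - 1 ≤ Module.finrank ℝ E := by
  obtain ⟨u, hu⟩ := IsReflectionAlong.of_finrank_eq_one (hn _) (ρ.apply_swap_apply_swap a b) h1
  refine h.card_sub_one_le_of_isReflectionAlong hn fun c d hcd => ?_
  have hi : ∀ {p q : α}, p ≠ q → Function.Injective ![p, q] := by
    intro p q h1 i j hij
    fin_cases i <;> fin_cases j <;> simp_all
  obtain ⟨g, hg⟩ := Perm.exists_extending_pair _ _ (hi hab) (hi hcd)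
  have h0 : g a = c := by simpa using hg 0
  have h1 : g b = d := by simpa using hg 1
  have h2 := hu.conj hn g
  rw [← swap_apply_apply, h0, h1] at h2
  exact ⟨_, h2⟩

/-- If one transposition acts as a scalar, then all transpositions act as that scalar. -/
theorem SeparatesDisjointSwaps.map_swap_ne_smul_one (h : SeparatesDisjointSwaps ρ) {a b : α}
    (hab : a ≠ b) (c : ℝ) : ρ (swap a b) ≠ c • 1 := by
  intro heq
  have hall : ∀ x y : α, x ≠ y → ρ (swap x y) = c • 1 := by
    intro x y hxy
    have hi : ∀ {p q : α}, p ≠ q → Function.Injective ![p, q] := by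
      intro p q h1 i j hij
      fin_cases i <;> fin_cases j <;> simp_all
    obtain ⟨g, hg⟩ := Perm.exists_extending_pair _ _ (hi hab) (hi hxy)
    have h0 : g a = x := by simpa using hg 0
    have h1 : g b = y := by simpa using hg 1
    rw [← h0, ← h1, swap_apply_apply, map_mul, map_mul, heq, mul_smul_comm, mul_one,
      smul_mul_assoc, ← map_mul, mul_inv_cancel, map_one]
  obtain ⟨x, hx, hne⟩ := h
  exact hne (by rw [hall _ _ (hx.ne (by decide)), hall _ _ (hx.ne (by decide))])

theorem isCompl_eigenspace_one_neg_one {T : E →ₗ[ℝ] E} (hT : ∀ v, T (T v) = v) :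
    IsCompl (Module.End.eigenspace T 1) (Module.End.eigenspace T (-1)) := by
  constructor
  · rw [Submodule.disjoint_def]
    intro v h1 h2
    rw [Module.End.mem_eigenspace_iff] at h1 h2
    rw [h1, one_smul, neg_one_smul] at h2
    have h3 : (2 : ℝ) • v = 0 := by
      rw [two_smul]
      nth_rw 1 [h2]
      exact neg_add_cancel v
    exact (smul_eq_zero.1 h3).resolve_left two_ne_zero
  · rw [codisjoint_iff, eq_top_iff]
    intro v _
    have hv : v = (2⁻¹ : ℝ) • (v + T v) + (2⁻¹ : ℝ) • (v - T v) := by module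
    rw [hv]
    refine Submodule.add_mem_sup (Submodule.smul_mem _ _ ?_) (Submodule.smul_mem _ _ ?_)
    · rw [Module.End.mem_eigenspace_iff, map_add, hT, one_smul, add_comm]
    · rw [Module.End.mem_eigenspace_iff, map_sub, hT, neg_one_smul, neg_sub]

/-- The permutations of the points other than `e` and `f` preserve the eigenspaces of the
transposition `(e f)`. -/
noncomputable def swapEigenspace (ρ : Representation ℝ (Perm α) E) (e f : α) (c : ℝ) :
    Subrepresentation (ρ.comp (Perm.ofSubtype (p := fun x : α => x ≠ e ∧ x ≠ f))) where
  toSubmodule := Module.End.eigenspace (ρ (swap e f)) c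
  apply_mem_toSubmodule g v hv := by
    rw [Module.End.mem_eigenspace_iff] at hv ⊢
    have h1 : Perm.ofSubtype g * swap e f = swap e f * Perm.ofSubtype g := by
      rw [mul_swap_eq_swap_mul, Perm.ofSubtype_apply_of_not_mem g (by simp),
        Perm.ofSubtype_apply_of_not_mem g (by simp)]
    have h2 := congrArg (fun s => ρ s v) h1
    simp only [map_mul, Module.End.mul_apply] at h2
    rw [hv, map_smul] at h2
    exact h2.symm

/-- Lower bound by induction on the number of points. If the dimension were smaller, the induction
hypothesis for the permutations commuting with a transposition would leave one of the eigenspaces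
of that transposition with dimension `1`, so transpositions would act as reflections up to sign. -/
theorem SeparatesDisjointSwaps.card_sub_one_le.{u, v} (n : ℕ) : ∀ {α : Type u} [DecidableEq α]
    [Fintype α] {E : Type v} [NormedAddCommGroup E] [InnerProductSpace ℝ E] [FiniteDimensional ℝ E]
    {ρ : Representation ℝ (Perm α) E}, SeparatesDisjointSwaps ρ → (∀ g v, ‖ρ g v‖ = ‖v‖) →
    Fintype.card α = n → n - 1 ≤ Module.finrank ℝ E := by
  induction n using Nat.strong_induction_on with
  | _ n ih =>
    intro α _ _ E _ _ _ ρ h hn hcard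
    by_contra! hlt
    obtain ⟨x, hx, hxne⟩ := id h
    obtain ⟨e, f, hef, hout⟩ : ∃ e f : α, e ≠ f ∧ (6 ≤ n → ∀ i, x i ≠ e ∧ x i ≠ f) := by
      rcases lt_or_ge n 6 with h6 | h6
      · exact ⟨x 0, x 1, hx.ne (by decide), fun h => absurd h (by omega)⟩
      · have hc : 1 < ((Finset.univ.image x)ᶜ).card := by
          rw [Finset.card_compl, Finset.card_image_of_injective _ hx, Finset.card_fin, hcard]
          omega
        obtain ⟨e, he, f, hf, hef⟩ := Finset.one_lt_card.1 hc
        simp only [Finset.mem_compl, Finset.mem_image, Finset.mem_univ, true_and,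
          not_exists] at he hf
        exact ⟨e, f, hef, fun _ i => ⟨he i, hf i⟩⟩
    set T := ρ (swap e f) with hT
    have hcompl : IsCompl (Module.End.eigenspace T 1) (Module.End.eigenspace T (-1)) :=
      isCompl_eigenspace_one_neg_one (ρ.apply_swap_apply_swap e f)
    have hsum := Submodule.finrank_add_eq_of_isCompl hcompl
    have hpos : ∀ c d : ℝ, IsCompl (Module.End.eigenspace T c) (Module.End.eigenspace T d) →
        0 < Module.finrank ℝ (Module.End.eigenspace T c) := by
      intro c d hcd
      rw [Nat.pos_iff_ne_zero]
      intro h0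
      rw [Submodule.finrank_eq_zero] at h0
      rw [h0] at hcd
      have htop := eq_top_of_bot_isCompl hcd
      refine h.map_swap_ne_smul_one hef d (LinearMap.ext fun v => ?_)
      exact Module.End.mem_eigenspace_iff.1
        (htop ▸ Submodule.mem_top : v ∈ Module.End.eigenspace T d)
    have hp1 := hpos _ _ hcompl
    have hp2 := hpos _ _ hcompl.symm
    have hone : Module.finrank ℝ (Module.End.eigenspace T 1) = 1 ∨
        Module.finrank ℝ (Module.End.eigenspace T (-1)) = 1 := by
      rcases lt_or_ge n 6 with h6 | h6
      · omega
      · let y : Fin 4 → {z : α // z ≠ e ∧ z ≠ f} := fun i => ⟨x i, hout h6 i⟩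
        have hy : Function.Injective y := fun i j hij => hx (congrArg Subtype.val hij)
        have hcard' : Fintype.card {z : α // z ≠ e ∧ z ≠ f} = n - 2 := by
          rw [Fintype.card_subtype, ← hcard, ← Finset.card_univ, ← Finset.card_pair hef,
            ← Finset.card_sdiff_of_subset (Finset.subset_univ _)]
          congr 1
          ext z
          simp
        have hind : ∀ c, SeparatesDisjointSwaps (swapEigenspace ρ e f c).toRepresentation →
            n - 3 ≤ Module.finrank ℝ (Module.End.eigenspace T c) := fun c hc =>
          ih (n - 2) (by omega) hc (fun g v => hn _ v.1) hcard'
        by_cases hs1 : SeparatesDisjointSwaps (swapEigenspace ρ e f 1).toRepresentation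
        · have := hind 1 hs1
          omega
        · by_cases hs2 : SeparatesDisjointSwaps (swapEigenspace ρ e f (-1)).toRepresentation
          · have := hind (-1) hs2
            omega
          · have hswap : ∀ i j, Perm.ofSubtype (swap (y i) (y j)) = swap (x i) (x j) := fun i j =>
              Perm.ofSubtype_swap_eq _ _
            have heq : ∀ c, ¬ SeparatesDisjointSwaps (swapEigenspace ρ e f c).toRepresentation →
                ∀ v ∈ Module.End.eigenspace T c,
                  ρ (swap (x 0) (x 1)) v = ρ (swap (x 2) (x 3)) v := by
              intro c hc v hv
              have h1 := not_not.1 fun hne => hc ⟨y, hy, hne⟩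
              have h2 := congrArg Subtype.val (LinearMap.congr_fun h1 ⟨v, hv⟩)
              change ρ (Perm.ofSubtype (swap (y 0) (y 1))) v =
                ρ (Perm.ofSubtype (swap (y 2) (y 3))) v at h2
              rwa [hswap, hswap] at h2
            refine absurd (LinearMap.ext fun v => ?_) hxne
            obtain ⟨a, ha, b, hb, rfl⟩ := Submodule.mem_sup.1
              (hcompl.sup_eq_top ▸ Submodule.mem_top : v ∈ _ ⊔ _)
            rw [map_add, map_add, heq 1 hs1 a ha, heq (-1) hs2 b hb]
    have hbound : n - 1 ≤ Module.finrank ℝ E := by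
      rcases hone with h1 | h1
      · rw [← hcard]
        refine h.signTwist.card_sub_one_le_of_finrank_eq_one (norm_signTwist_apply hn) hef ?_
        have h2 : Module.End.eigenspace (-T) (-1) = Module.End.eigenspace T 1 := by
          ext v
          simp
        rw [signTwist_swap hef, ← hT, h2, h1]
      · rw [← hcard]
        exact h.card_sub_one_le_of_finrank_eq_one hn hef h1
    omega

theorem perm_sub_one_le_of_faithful {n e : ℕ}
    (σ : Representation ℝ (Perm (Fin n)) (EuclideanSpace ℝ (Fin e)))
    (hσ : Function.Injective σ) (hn : ∀ g v, ‖σ g v‖ = ‖v‖) : n - 1 ≤ e := by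
  rcases lt_or_ge n 4 with h4 | h4
  · by_contra! hlt
    have hle : Module.finrank ℝ (EuclideanSpace ℝ (Fin e)) ≤ 1 := by
      rw [finrank_euclideanSpace_fin]
      omega
    -- In dimension at most `1` all operators commute, which rules out `n = 3`.
    have hcomm : ∀ g h : Perm (Fin n), g * h = h * g := by
      intro g h
      obtain ⟨v, hv⟩ := finrank_le_one_iff.1 hle
      refine hσ ?_
      rw [map_mul, map_mul]
      refine LinearMap.ext fun w => ?_
      obtain ⟨c, rfl⟩ := hv w
      obtain ⟨a, ha⟩ := hv (σ g v)
      obtain ⟨b, hb⟩ := hv (σ h v)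
      simp only [Module.End.mul_apply, map_smul]
      rw [← ha, ← hb, map_smul, map_smul, ← ha, ← hb, smul_comm a b]
    interval_cases n
    · omega
    · omega
    · have he : e = 0 := by omega
      subst he
      have h1 : swap (0 : Fin 2) 1 = 1 := hσ (LinearMap.ext fun v => Subsingleton.elim _ _)
      exact absurd h1 (by decide)
    · exact absurd (hcomm (swap 0 1) (swap 1 2)) (by decide)
  · have h := SeparatesDisjointSwaps.card_sub_one_le n (ρ := σ)
      ⟨Fin.castLE h4, Fin.castLE_injective h4, fun heq => ?_⟩ hn (Fintype.card_fin n)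
    · rwa [finrank_euclideanSpace_fin] at h
    · have h1 := congrArg (fun g : Perm (Fin n) => g (Fin.castLE h4 0)) (hσ heq)
      have h2 : ∀ i j : Fin 4, i ≠ j → Fin.castLE h4 i ≠ Fin.castLE h4 j := fun i j =>
        (Fin.castLE_injective h4).ne
      simp only [swap_apply_left] at h1
      rw [swap_apply_of_ne_of_ne (h2 _ _ (by decide)) (h2 _ _ (by decide))] at h1
      exact h2 _ _ (by decide) h1

theorem hasGcpd_perm {n : ℕ} (hn : 1 ≤ n) : HasGcpd (Perm (Fin n)) (n - 1) := by
  have : Nonempty (Fin n) := ⟨⟨0, hn⟩⟩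
  have h := hasGcpd_of_transitive (G := Perm (Fin n)) (ι := Fin n) fun e σ hσ hiso => by
    rw [Fintype.card_fin]
    exact perm_sub_one_le_of_faithful σ hσ hiso
  rwa [Fintype.card_fin] at h

end SymmetricGroup

theorem theorem4p7 :
    (∀ n : ℕ, 1 ≤ n → HasGcpd (Equiv.Perm (Fin n)) (n - 1)) ∧
    (∀ (p k : ℕ) (Γ : Type*) [Group Γ], p.Prime → Odd p → IsExtraspecial p Γ →
      Nat.card Γ = p ^ (2 * k + 1) → HasGcpd Γ (2 * p ^ k)) ∧
    (∀ (q : ℕ) (K : Type*) [Field K] [Finite K], Nat.card K = q →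
      HasGcpd (affineGroup K) (q - 1)) := by
  refine ⟨fun n hn => hasGcpd_perm hn, fun p k Γ _ hp hodd h hcard => ?_, fun q K _ _ hq => ?_⟩
  · exact hasGcpd_of_isExtraspecial hp hodd h hcard
  · rw [← hq]
    exact hasGcpd_affineGroup
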